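/- For every $d\ge 1$ let $C_d$ be a symmetric positive definite $d\times d$ real matrix with eigenvalues $c_{1},\dots,c_{d}$ (depending on $d$), and let $\rho=\rho_d$ be the centred Gaussian density on $\mathbb R^d$ with covariance $C_d$. Assume that $\frac1d\sum_r\delta_{c_r}$ converges, in the sense of distributions, to a probability measure $\rho_C$ as $d\to\infty$, and that $\mathbb E_{x\sim\rho}|x|^2=O(d)$. Definitions. For $h>0$, $\lambda\ge 0$, $x\in\mathbb R^d$ put $\tilde f_{d,x,h}(\lambda)=\frac1d\log\mathbb E_{y\sim\rho}\,e^{-d\lambda u}$ with $u=|x-y|^2/(dh^2)$. A (sequence of) density $\rho$ is *pure* if for all $h>0$ and $\lambda\ge0$ the random variable $\tilde f_{d,x,h}(\lambda)$, $x\sim\rho$, is integrable and concentrates around its mean: for every $\varepsilon>0$, $\mathbb P_{x\sim\rho}\big(|\tilde f_{d,x,h}(\lambda)-\mathbb E_{x'\sim\rho}\tilde f_{d,x',h}(\lambda)|\ge\varepsilon\big)\to0$ as $d\to\infty$. For $\gamma\ge1$ the *$\gamma$-kernel* on $\mathbb R^d$ is $K_\gamma(x)=\exp\big(d\,[c_{\gamma,d}-\frac1{2\gamma}(|x|^2/d)^\gamma]\big)$,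 with $c_{\gamma,d}$ the constant for which $\int K_\gamma=1$. For $m>0$, $h>0$, $\alpha\in\mathbb R$, the *replica free entropy* of a kernel $K$ is $$\phi_{\alpha,h}(m)=\frac{1-m}{m}\alpha+\frac1m\,\overline g(h^2,m),\qquad \overline g(h^2,m)=\lim_{d\to\infty}\frac1d\,\mathbb E_{x\sim\rho}\log\mathbb E_{y\sim\rho}\Big[K\Big(\frac{x-y}h\Big)^m\Big]-m\log h .$$ Put $f_\gamma(u)=u^\gamma/(2\gamma)$ and $c_\gamma=-\frac12\big(\log(2\pi)+1-\frac1\gamma\big)$. Then $\rho$ is a pure density, and $\rho_C$ is carried by $[0,\infty)$ and has a finite mean. Moreover, for all $\gamma\ge1$, $\alpha\in\mathbb R$, $h>0$, $m>0$: (i) the two equations $$\frac{\hat l}{2}=\frac{m}{h^2}f_\gamma'\Big(\frac l{h^2}\Big),\qquad l=\int\rho_C(d\lambda)\Big(\frac{\lambda}{1+\hat l\lambda}+\frac{\lambda}{(1+\hat l\lambda)^2}\Big)$$ have a unique solution $(l,\hat l)\in[0,\infty)^2$, and on $[0,\infty)^2$ they hold if and only if the right-hand side of (1) is stationary with respect to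 $l$ and $\hat l$ (with one-sided derivatives on the boundary); (ii) with this pair $(l,\hat l)$, the limit $\overline g(h^2,m)$ for the $\gamma$-kernel exists and $$\phi_{\alpha,h}(m)=\frac{1-m}m\alpha+c_\gamma-f_\gamma\Big(\frac l{h^2}\Big)-\log h-\frac1{2m}\int\rho_C(d\lambda)\log(1+\hat l\lambda)-\frac1{2m}\int\rho_C(d\lambda)\frac{\hat l\lambda}{1+\hat l\lambda}+\frac{\hat l\,l}{2m};\tag{1}$$ (iii) for the Gaussian kernel ($\gamma=1$) one has $\hat l=m/h^2$ and $$\phi_{\alpha,h}(m)=\frac{1-m}m\alpha+\frac{1-m}m\log h-\frac12\log(2\pi)-\frac1{2m}\int\rho_C(d\lambda)\log(h^2+m\lambda)-\frac12\int\rho_C(d\lambda)\frac{\lambda}{h^2+m\lambda}.$$ -/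

import Mathlib

open MeasureTheory ProbabilityTheory Filter Topology Asymptotics Set

noncomputable section

/-- The empirical eigenvalue distributions `(1/d) ∑ᵣ δ_{cᵣ}` of the symmetric matrices `C d`
converge to the measure `ρC` in the sense of distributions (test functions: smooth with compact
support). -/
def HasLimitingEigenvalueDensity (C : ∀ d : ℕ, Matrix (Fin d) (Fin d) ℝ)
    (hC : ∀ d, (C d).IsHermitian) (ρC : Measure ℝ) : Prop :=
  ∀ φ : ℝ → ℝ, ContDiff ℝ (⊤ : ℕ∞) φ → HasCompactSupport φ →
    Tendsto (fun d : ℕ => (1 / (d : ℝ)) * ∑ r, φ ((hC d).eigenvalues r)) atTop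
      (𝓝 (∫ c, φ c ∂ρC))

/-- The cumulant generating function `(1/d) log E_u[exp (-d lam u)]` of
`u = |x - y|² / (d h²)`, for fixed `x`, with `y` sampled from `ρ`. -/
def cumulantGen (d : ℕ) (ρ : Measure (EuclideanSpace ℝ (Fin d))) (h lam : ℝ)
    (x : EuclideanSpace ℝ (Fin d)) : ℝ :=
  (1 / (d : ℝ)) *
    Real.log (∫ y, Real.exp (-((d : ℝ) * lam * (‖x - y‖ ^ 2 / ((d : ℝ) * h ^ 2)))) ∂ρ)

/-- The random variables `X d`, defined on the probability spaces `(Ω d, P d)`, have a mean and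
concentrate around it as `d → ∞`. -/
def ConcentratesAroundMean {Ω : ℕ → Type*} [∀ d, MeasurableSpace (Ω d)]
    (P : ∀ d, Measure (Ω d)) (X : ∀ d, Ω d → ℝ) : Prop :=
  (∀ d, Integrable (X d) (P d)) ∧
  ∀ ε : ℝ, 0 < ε →
    Tendsto (fun d => P d {x | ε ≤ |X d x - ∫ z, X d z ∂(P d)|}) atTop (𝓝 0)

/-- Pure densities: probability densities on `ℝ^d`, `d = 1, 2, …`, such that for every bandwidth
`h > 0` and every `lam ≥ 0` the cumulant generating function of `u = |x - y|² / (d h²)`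
concentrates around its mean when `x` is sampled from the density. -/
def IsPureDensity (ρ : ∀ d : ℕ, Measure (EuclideanSpace ℝ (Fin d))) : Prop :=
  (∀ d, IsProbabilityMeasure (ρ d)) ∧ (∀ d, ρ d ≪ volume) ∧
  ∀ h lam : ℝ, 0 < h → 0 ≤ lam →
    ConcentratesAroundMean ρ (fun d => cumulantGen d (ρ d) h lam)

/-- The normalization constant of the `γ`-kernel in dimension `d`: the number `c` such that
`exp (d (c - (1/(2γ)) (|x|²/d)^γ))` has integral one. -/
def gammaNormalization (d : ℕ) (γ : ℝ) : ℝ :=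
  -((1 / (d : ℝ)) * Real.log (∫ x : EuclideanSpace ℝ (Fin d),
      Real.exp (-((d : ℝ) * (1 / (2 * γ) * (‖x‖ ^ 2 / (d : ℝ)) ^ γ)))))

/-- The `γ`-kernel on `ℝ^d`. -/
def gammaKernel (γ : ℝ) (d : ℕ) (x : EuclideanSpace ℝ (Fin d)) : ℝ :=
  Real.exp ((d : ℝ) * (gammaNormalization d γ - 1 / (2 * γ) * (‖x‖ ^ 2 / (d : ℝ)) ^ γ))

/-- `log E_y[K((x - y)/h)^m]` as a function of `x`, with `y` sampled from `ρ`. -/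
def logKernelMoment (d : ℕ) (ρ : Measure (EuclideanSpace ℝ (Fin d)))
    (K : EuclideanSpace ℝ (Fin d) → ℝ) (h m : ℝ) (x : EuclideanSpace ℝ (Fin d)) : ℝ :=
  Real.log (∫ y, (K (h⁻¹ • (x - y))) ^ m ∂ρ)

/-- `φ` is the replica free entropy `φ_{α,h}(m) = ((1-m)/m) α + (1/m) g`, where `g` is the limit
of `(1/d) E_x[log E_y[K((x - y)/h)^m]] - m log h` as `d → ∞` (which is required to exist). -/
def IsReplicaFreeEntropy (ρ : ∀ d : ℕ, Measure (EuclideanSpace ℝ (Fin d)))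
    (K : ∀ d : ℕ, EuclideanSpace ℝ (Fin d) → ℝ) (α h m φ : ℝ) : Prop :=
  (∀ d, Integrable (logKernelMoment d (ρ d) (K d) h m) (ρ d)) ∧
  ∃ g : ℝ,
    Tendsto (fun d : ℕ =>
      (1 / (d : ℝ)) * (∫ x, logKernelMoment d (ρ d) (K d) h m x ∂(ρ d)) - m * Real.log h)
      atTop (𝓝 g) ∧
    φ = (1 - m) / m * α + 1 / m * g

/-- The function `f_γ(u) = u^γ / (2γ)`. -/
def fGamma (γ u : ℝ) : ℝ := u ^ γ / (2 * γ)

/-- The large `d` value of the normalization constant of the `γ`-kernel. -/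
def cGamma (γ : ℝ) : ℝ := -(1 / 2) * (Real.log (2 * Real.pi) + 1 - 1 / γ)

/-- The replica free entropy of the Gaussian density as a function of the pair `(l, l̂)`, here
`(l, t)`. -/
def phiGauss (ρC : Measure ℝ) (γ α h m l t : ℝ) : ℝ :=
  (1 - m) / m * α + cGamma γ - fGamma γ (l / h ^ 2) - Real.log h
    - 1 / (2 * m) * (∫ c, Real.log (1 + t * c) ∂ρC)
    - 1 / (2 * m) * (∫ c, t * c / (1 + t * c) ∂ρC)
    + t * l / (2 * m)

/-- The two equations for the pair `(l, l̂)`, here `(l, t)`. -/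
def SaddleEquations (ρC : Measure ℝ) (γ h m l t : ℝ) : Prop :=
  t / 2 = m / h ^ 2 * deriv (fGamma γ) (l / h ^ 2) ∧
  l = ∫ c, (c / (1 + t * c) + c / (1 + t * c) ^ 2) ∂ρC

/-- `phiGauss` is stationary at `(l, t)` with respect to both variables on `[0, ∞) × [0, ∞)`
(derivatives are one-sided on the boundary). -/
def IsStationaryPhiGauss (ρC : Measure ℝ) (γ α h m l t : ℝ) : Prop :=
  HasDerivWithinAt (fun l' => phiGauss ρC γ α h m l' t) 0 (Ici 0) l ∧
  HasDerivWithinAt (fun t' => phiGauss ρC γ α h m l t') 0 (Ici 0) t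

/-- The closed form of the replica free entropy for the Gaussian kernel. -/
def phiGaussKernel (ρC : Measure ℝ) (α h m : ℝ) : ℝ :=
  (1 - m) / m * α + (1 - m) / m * Real.log h - 1 / 2 * Real.log (2 * Real.pi)
    - 1 / (2 * m) * (∫ c, Real.log (h ^ 2 + m * c) ∂ρC)
    - 1 / 2 * (∫ c, c / (h ^ 2 + m * c) ∂ρC)

end

/-! In the eigenbasis of the covariance, both Gaussian points become standard vectors `z`, `y`, and
the squared distance becomes `W = ∑ c i * (z i - y i) ^ 2`. Up to the normalization constant,
everything reduces to `log E_y exp (-a * W ^ γ)` averaged over `z`, with `a` of order `d ^ (1 - γ)`.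
For a quadratic exponent this is an explicit Gaussian integral; convexity of `x ↦ x ^ γ` and a
Gaussian trial measure compare the general case with it.

Upper bound (`integral_logPowerMoment_le`): replace `W ^ γ` by its tangent line at `q = d * l`. The
first saddle equation says that the resulting quadratic exponent is `-(t / 2) * W`.

Lower bound (`le_integral_logPowerMoment`): use the measure tilted by `-(t / 2) * W` as trial
measure in the Gibbs variational principle. It is Gaussian, and after averaging over `z` too, `W`
has the law of `∑ tiltedVar t (c i) * w i ^ 2` with `w` standard. For `t > 0` these weights are at
most `2 / t` whatever the eigenvalues are, so `W / d` concentrates and `E (W / d) ^ γ` is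
asymptotically at most the `γ`-th power of the mean (`exists_integral_rpow_mean_le`). The second
saddle equation says that this mean tends to `l`, so the two bounds meet.

The spectral averages converge because the functions involved grow sublinearly and the mean
eigenvalue is bounded (`IsSpectralArray.tendsto_of_isLittleO`). The normalization constant is
treated by the same sandwich, with Lebesgue measure as base and the standard Gaussian as trial
measure. Purity follows since, for a quadratic exponent, the log-moment is a constant plus a
weighted sum of independent squares with weights at most `1 / 2` in absolute value. Uniqueness of
the saddle point is monotonicity: one equation makes `t` nondecreasing in `l`, the other makes `l`
nonincreasing in `t`. -/

/-! ### Gaussian measures, quadratic tilts and diagonalisation -/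

/-- A product of exponentially tilted measures is an exponentially tilted product. -/
lemma pi_tilted {ι : Type*} [Fintype ι] (μ : ι → Measure ℝ) [∀ i, SigmaFinite (μ i)]
    (f : ι → ℝ → ℝ) :
    Measure.pi (fun i => (μ i).tilted (f i)) = (Measure.pi μ).tilted (fun x => ∑ i, f i (x i)) := by
  refine Measure.pi_eq (μ := fun i => (μ i).tilted (f i)) fun s hs => ?_
  rw [tilted_apply_eq_ofReal_integral' _ (MeasurableSet.univ_pi hs)]
  simp_rw [fun i => tilted_apply_eq_ofReal_integral' (μ := μ i) (f i) (hs i)]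
  rw [← ENNReal.ofReal_prod_of_nonneg (fun i _ => integral_nonneg fun x => by positivity)]
  congr 1
  rw [Measure.restrict_pi_pi, ← integral_fintype_prod_eq_prod]
  congr 1
  ext x
  simp_rw [Real.exp_sum]
  rw [integral_fintype_prod_eq_prod (f := fun i x => Real.exp (f i x)), Finset.prod_div_distrib]

lemma integrable_exp_neg_sq_div (μ v : ℝ) (hv : 0 < v) :
    Integrable (fun x : ℝ => Real.exp (-(x - μ) ^ 2 / (2 * v))) := by
  have h := (integrable_exp_neg_mul_sq (b := 1 / (2 * v)) (by positivity)).comp_sub_right μ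
  refine h.congr (ae_of_all _ fun x => ?_)
  simp only
  congr 1
  field_simp

lemma integral_exp_neg_sq_div (μ v : ℝ) :
    ∫ x : ℝ, Real.exp (-(x - μ) ^ 2 / (2 * v)) = √(2 * Real.pi * v) := by
  have h := integral_sub_right_eq_self (μ := volume)
    (fun x : ℝ => Real.exp (-(1 / (2 * v)) * x ^ 2)) μ
  rw [integral_gaussian] at h
  rw [show 2 * Real.pi * v = Real.pi / (1 / (2 * v)) by rw [div_div_eq_mul_div]; ring, ← h]
  congr 1
  ext x
  congr 1
  ring

lemma gaussianReal_eq_tilted (μ v : ℝ) (hv : 0 < v) :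
    gaussianReal μ v.toNNReal = (volume : Measure ℝ).tilted (fun x => -(x - μ) ^ 2 / (2 * v)) := by
  rw [gaussianReal_of_var_ne_zero _ (by simpa using hv), Measure.tilted]
  congr 1
  ext x
  rw [gaussianPDF, gaussianPDFReal, integral_exp_neg_sq_div, Real.coe_toNNReal _ hv.le]
  congr 1
  rw [div_eq_inv_mul _ (√_)]

/-- Completing the square gives precision `1 + κ` and mean `κ * z / (1 + κ)`. The pushforward form
exhibits the tilted variable as linear in `z` and an independent noise `w`, which is what allows `z`
to be averaged later. -/
lemma gaussianReal_tilted_sq (κ z : ℝ) (hκ : 0 ≤ κ) :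
    (gaussianReal 0 1).tilted (fun y => -(κ / 2 * (z - y) ^ 2)) =
      (gaussianReal 0 1).map (fun w => κ * z / (1 + κ) + 1 / √(1 + κ) * w) := by
  have h1 : gaussianReal 0 1 = (volume : Measure ℝ).tilted (fun x => -(x - 0) ^ 2 / (2 * 1)) := by
    have := gaussianReal_eq_tilted 0 1 one_pos
    simpa using this
  have hm : (gaussianReal 0 1).map (fun w => κ * z / (1 + κ) + 1 / √(1 + κ) * w) =
      gaussianReal (κ * z / (1 + κ)) (1 / (1 + κ)).toNNReal := by
    have := gaussianReal_map_const_add (μ := 0) (v := (1 / (1 + κ)).toNNReal) (κ * z / (1 + κ))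
    rw [zero_add] at this
    rw [← this]
    have h2 := gaussianReal_map_const_mul (μ := 0) (v := 1) (1 / √(1 + κ))
    have h3 : NNReal.mk ((1 / √(1 + κ)) ^ 2) (sq_nonneg _) * 1 = (1 / (1 + κ)).toNNReal := by
      ext
      rw [Real.coe_toNNReal _ (by positivity : 0 ≤ 1 / (1 + κ))]
      simp [Real.sq_sqrt (by positivity : 0 ≤ 1 + κ)]
    rw [mul_zero] at h2
    rw [← h3, ← h2, Measure.map_map (by fun_prop) (by fun_prop)]
    rfl
  rw [hm, gaussianReal_eq_tilted _ _ (by positivity), h1,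
    tilted_tilted (integrable_exp_neg_sq_div 0 1 one_pos)]
  have key : ((fun x => -(x - 0) ^ 2 / (2 * 1)) + fun y => -(κ / 2 * (z - y) ^ 2)) =
      (fun x => -(x - κ * z / (1 + κ)) ^ 2 / (2 * (1 / (1 + κ)))) +
        fun _ => -(κ * z ^ 2 / (2 * (1 + κ))) := by
    ext x
    simp only [Pi.add_apply]
    field_simp
    ring
  rw [key]
  rw [← tilted_tilted (integrable_exp_neg_sq_div _ _ (by positivity))]
  have := isProbabilityMeasure_tilted (μ := (volume : Measure ℝ))
    (integrable_exp_neg_sq_div (κ * z / (1 + κ)) (1 / (1 + κ)) (by positivity))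
  rw [tilted_const]

lemma integral_gaussianReal_exp_neg_sq (κ z : ℝ) (hκ : 0 ≤ κ) :
    ∫ y, Real.exp (-(κ / 2 * (z - y) ^ 2)) ∂(gaussianReal 0 1) =
      (√(1 + κ))⁻¹ * Real.exp (-(κ * z ^ 2 / (2 * (1 + κ)))) := by
  rw [integral_gaussianReal_eq_integral_smul one_ne_zero]
  have : ∀ y, gaussianPDFReal 0 1 y • Real.exp (-(κ / 2 * (z - y) ^ 2)) =
      ((√(2 * Real.pi))⁻¹ * Real.exp (-(κ * z ^ 2 / (2 * (1 + κ))))) *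
        Real.exp (-(y - κ * z / (1 + κ)) ^ 2 / (2 * (1 / (1 + κ)))) := by
    intro y
    simp only [gaussianPDFReal, smul_eq_mul, NNReal.coe_one, mul_one]
    rw [mul_assoc, mul_assoc, ← Real.exp_add, ← Real.exp_add]
    congr 2
    field_simp
    ring
  simp_rw [this]
  rw [integral_const_mul, integral_exp_neg_sq_div, mul_one_div, Real.sqrt_div (by positivity)]
  have : √(2 * Real.pi) ≠ 0 := by positivity
  field_simp

section Pi

variable {ι : Type*} [Fintype ι]

/-- The standard Gaussian measure on `ι → ℝ`. -/
noncomputable abbrev gaussianPi (ι : Type*) [Fintype ι] : Measure (ι → ℝ) :=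
  Measure.pi (fun _ : ι => gaussianReal 0 1)

lemma gaussianPi_tilted_sq (κ z : ι → ℝ) (hκ : ∀ i, 0 ≤ κ i) :
    (gaussianPi ι).tilted (fun y => ∑ i, -(κ i / 2 * (z i - y i) ^ 2)) =
      (gaussianPi ι).map (fun w i => κ i * z i / (1 + κ i) + 1 / √(1 + κ i) * w i) := by
  rw [← pi_tilted _ (fun i y => -(κ i / 2 * (z i - y) ^ 2))]
  simp_rw [fun i => gaussianReal_tilted_sq (κ i) (z i) (hκ i)]
  rw [Measure.pi_map_pi (f := fun i w => κ i * z i / (1 + κ i) + 1 / √(1 + κ i) * w)]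
  fun_prop

lemma log_integral_gaussianPi_exp_neg_sq (κ z : ι → ℝ) (hκ : ∀ i, 0 ≤ κ i) :
    Real.log (∫ y, Real.exp (∑ i, -(κ i / 2 * (z i - y i) ^ 2)) ∂(gaussianPi ι)) =
      ∑ i, (-(1 / 2) * Real.log (1 + κ i) - κ i / (2 * (1 + κ i)) * z i ^ 2) := by
  simp_rw [Real.exp_sum]
  rw [integral_fintype_prod_eq_prod (f := fun i y => Real.exp (-(κ i / 2 * (z i - y) ^ 2)))]
  simp_rw [fun i => integral_gaussianReal_exp_neg_sq (κ i) (z i) (hκ i)]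
  rw [Real.log_prod (fun i _ => by have := hκ i; positivity)]
  refine Finset.sum_congr rfl fun i _ => ?_
  have := hκ i
  rw [Real.log_mul (by positivity) (by positivity), Real.log_exp, Real.log_inv,
    Real.log_sqrt (by positivity)]
  ring

lemma gaussianReal_prod_map_add (a b s : ℝ) (h : s ^ 2 = a ^ 2 + b ^ 2) :
    ((gaussianReal 0 1).prod (gaussianReal 0 1)).map (fun p => a * p.1 + b * p.2) =
      (gaussianReal 0 1).map (fun w => s * w) := by
  rw [gaussianReal_map_const_mul]
  have h1 := gaussianReal_map_const_mul (μ := 0) (v := 1) a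
  have h2 := gaussianReal_map_const_mul (μ := 0) (v := 1) b
  have h3 : (fun p : ℝ × ℝ => a * p.1 + b * p.2) =
    (fun p : ℝ × ℝ => p.1 + p.2) ∘ (Prod.map (fun w => a * w) (fun w => b * w)) := rfl
  rw [h3, ← Measure.map_map (by fun_prop) (by fun_prop),
    ← Measure.map_prod_map _ _ (by fun_prop) (by fun_prop), h1, h2]
  change (gaussianReal _ _).conv (gaussianReal _ _) = _
  rw [gaussianReal_conv_gaussianReal]
  congr 1
  · simp
  · ext; simp [h]

lemma gaussianPi_prod_map_add (a b s : ι → ℝ) (h : ∀ i, s i ^ 2 = a i ^ 2 + b i ^ 2) :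
    ((gaussianPi ι).prod (gaussianPi ι)).map (fun p i => a i * p.1 i + b i * p.2 i) =
      (gaussianPi ι).map (fun w i => s i * w i) := by
  have h1 := (measurePreserving_arrowProdEquivProdArrow ℝ ℝ ι
    (fun _ => gaussianReal 0 1) (fun _ => gaussianReal 0 1)).map_eq
  rw [gaussianPi, ← h1, Measure.map_map (by fun_prop) (MeasurableEquiv.measurable _)]
  have h2 : (fun (p : (ι → ℝ) × (ι → ℝ)) i => a i * p.1 i + b i * p.2 i) ∘
      (MeasurableEquiv.arrowProdEquivProdArrow ℝ ℝ ι) =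
      fun q i => (fun r : ℝ × ℝ => a i * r.1 + b i * r.2) (q i) := rfl
  rw [h2, Measure.pi_map_pi (μ := fun _ : ι => (gaussianReal 0 1).prod (gaussianReal 0 1))
    (f := fun i (r : ℝ × ℝ) => a i * r.1 + b i * r.2) (by fun_prop)]
  simp_rw [fun i => gaussianReal_prod_map_add (a i) (b i) (s i) (h i)]
  rw [Measure.pi_map_pi (f := fun i w => s i * w)]
  fun_prop

/-- The Gaussian measure with covariance matrix `S` is the image of the standard Gaussian measure
under the linear map determined by the eigenvalues and eigenvectors of `S`. -/
lemma multivariateGaussian_eq_map_gaussianPi [DecidableEq ι] {S : Matrix ι ι ℝ}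
    (hS : S.PosSemidef) :
    multivariateGaussian 0 S = (gaussianPi ι).map
      (fun z => ∑ i, (√(hS.isHermitian.eigenvalues i) * z i) •
        hS.isHermitian.eigenvectorBasis i) := by
  set b := hS.isHermitian.eigenvectorBasis
  set c := hS.isHermitian.eigenvalues
  -- Characteristic functions are compared: independence factors the pushforward side, and the
  -- quadratic form of `S` splits over the eigenbasis.
  apply Measure.ext_of_charFun
  ext t
  rw [charFun_multivariateGaussian hS, charFun_apply,
    integral_map (Measurable.aemeasurable (by fun_prop))
    (Measurable.aestronglyMeasurable (by fun_prop))]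
  simp_rw [sum_inner, Complex.ofReal_sum, Finset.sum_mul, Complex.exp_sum]
  rw [integral_fintype_prod_eq_prod
    (f := fun i x ↦ Complex.exp ((inner ℝ ((√(c i) * x) • b i) t : ℝ) * Complex.I))]
  have h1 : ∀ i, ∫ x, Complex.exp ((inner ℝ ((√(c i) * x) • b i) t : ℝ) * Complex.I)
      ∂(gaussianReal 0 1) = Complex.exp (((-(c i * (inner ℝ (b i) t) ^ 2 / 2) : ℝ) : ℂ)) := by
    intro i
    have h := charFun_gaussianReal (μ := 0) (v := 1) (√(c i) * inner ℝ (b i) t)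
    rw [charFun_apply_real] at h
    have h2 : ∀ x : ℝ, (inner ℝ ((√(c i) * x) • b i) t : ℝ) = √(c i) * inner ℝ (b i) t * x := by
      intro x
      rw [real_inner_smul_left]
      ring
    simp_rw [h2]
    push_cast at h ⊢
    rw [h]
    congr 1
    have h3 : (√(c i) : ℂ) ^ 2 = c i := by
      rw [← Complex.ofReal_pow, Real.sq_sqrt (hS.eigenvalues_nonneg i)]
    rw [mul_pow, h3]
    simp
  simp_rw [h1, ← Complex.exp_sum]
  congr 1
  have h4 : t ⬝ᵥ S.mulVec t = ∑ i, c i * (inner ℝ (b i) t) ^ 2 := by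
    have hT : ∀ i, inner ℝ (b i) (WithLp.toLp 2 (S.mulVec t)) = c i * inner ℝ (b i) t := by
      intro i
      have h5 := hS.isHermitian.mulVec_eigenvectorBasis i
      have h6 : ∀ u v : ι → ℝ, inner ℝ (WithLp.toLp 2 u) (WithLp.toLp 2 v) = u ⬝ᵥ v := by
        intro u v
        rw [EuclideanSpace.inner_toLp_toLp]
        simp [dotProduct_comm]
      have h7 := h6 (b i) (S.mulVec t)
      have h8 := h6 (b i) t
      simp only [WithLp.toLp_ofLp] at h7 h8
      rw [h7, h8, Matrix.dotProduct_mulVec, ← Matrix.mulVec_transpose]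
      have h9 : S.transpose = S := by simpa using hS.isHermitian.eq
      rw [h9, h5, smul_dotProduct, smul_eq_mul]
    have h10 : t ⬝ᵥ S.mulVec t = inner ℝ (WithLp.toLp 2 (S.mulVec t)) t := by
      rw [PiLp.inner_apply]
      simp [dotProduct]
    rw [h10, ← b.sum_inner_mul_inner]
    refine Finset.sum_congr rfl fun i _ => ?_
    rw [real_inner_comm, hT]
    ring
  rw [h4]
  simp [Finset.sum_div]

end Pi

/-! ### Moments and concentration of weighted sums of squares -/

/-- Tangent line inequality for the convex function `x ↦ x ^ γ` on `[0, ∞)`. -/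
lemma rpow_add_mul_sub_le_rpow {γ x y : ℝ} (hγ : 1 ≤ γ) (hx : 0 ≤ x) (hy : 0 ≤ y) :
    x ^ γ + γ * x ^ (γ - 1) * (y - x) ≤ y ^ γ := by
  rcases hx.eq_or_lt with rfl | hx
  · rcases hγ.eq_or_lt with rfl | hγ
    · simp
    · rw [Real.zero_rpow (by linarith), Real.zero_rpow (by linarith)]
      simpa using Real.rpow_nonneg hy γ
  · have h := one_add_mul_self_le_rpow_one_add (s := y / x - 1) (by
      have : 0 ≤ y / x := by positivity
      linarith) hγ
    rw [add_sub_cancel, Real.div_rpow hy hx.le, le_div_iff₀ (by positivity)] at h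
    refine le_trans (le_of_eq ?_) h
    rw [Real.rpow_sub_one hx.ne']
    field_simp

lemma rpow_le_one_add_pow {x a : ℝ} {n : ℕ} (hx : 0 ≤ x) (ha : 0 ≤ a) (han : a ≤ n) :
    x ^ a ≤ 1 + x ^ n := by
  rcases le_total x 1 with h | h
  · have := Real.rpow_le_one hx h ha
    have : 0 ≤ x ^ n := by positivity
    linarith
  · have := Real.rpow_le_rpow_of_exponent_le h han
    rw [Real.rpow_natCast] at this
    linarith

lemma memLp_sq_gaussianReal (n : ℕ) :
    MemLp (fun x : ℝ => x ^ 2) n (gaussianReal 0 1) := by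
  rcases eq_or_ne n 0 with rfl | hn
  · simpa using (Measurable.aestronglyMeasurable (by fun_prop))
  rw [← integrable_norm_rpow_iff (Measurable.aestronglyMeasurable (by fun_prop))
    (by simpa using hn) (by simp)]
  have h := (memLp_id_gaussianReal' (μ := 0) (v := 1) (2 * n : ℕ)
    (ENNReal.natCast_ne_top _)).integrable_norm_pow
    (by omega)
  refine h.congr (ae_of_all _ fun x => ?_)
  simp only [id, ENNReal.toReal_natCast, Real.rpow_natCast]
  rw [norm_pow, ← pow_mul]

lemma integral_sq_gaussianReal : ∫ x, x ^ 2 ∂(gaussianReal 0 1) = 1 := by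
  have h := variance_fun_id_gaussianReal (μ := 0) (v := 1)
  rw [variance_eq_integral (by fun_prop)] at h
  simpa using h

section

variable {ι : Type*} [Fintype ι]

lemma memLp_sum_mul_sq_gaussianPi (β : ι → ℝ) (n : ℕ) :
    MemLp (fun w : ι → ℝ => ∑ i, β i * w i ^ 2) n (gaussianPi ι) := by
  refine memLp_finsetSum _ fun i _ => MemLp.const_mul ?_ _
  exact (memLp_sq_gaussianReal n).comp_measurePreserving
    (measurePreserving_eval (fun _ : ι => gaussianReal 0 1) i)

lemma integrable_sum_mul_sq_gaussianPi (β : ι → ℝ) :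
    Integrable (fun w : ι → ℝ => ∑ i, β i * w i ^ 2) (gaussianPi ι) := by
  have := memLp_sum_mul_sq_gaussianPi β 1
  rwa [Nat.cast_one, memLp_one_iff_integrable] at this

lemma integral_sum_mul_sq_gaussianPi (β : ι → ℝ) :
    ∫ w, ∑ i, β i * w i ^ 2 ∂(gaussianPi ι) = ∑ i, β i := by
  have h1 : Integrable (fun x : ℝ => x ^ 2) (gaussianReal 0 1) := by
    have := memLp_sq_gaussianReal 1
    rwa [Nat.cast_one, memLp_one_iff_integrable] at this
  have h2 : ∀ i, Integrable (fun w : ι → ℝ => w i ^ 2) (gaussianPi ι) := fun i =>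
    integrable_comp_eval (X := fun _ : ι => ℝ) (μ := fun _ => gaussianReal 0 1) (i := i) h1
  rw [integral_finsetSum _ fun i _ => (h2 i).const_mul _]
  refine Finset.sum_congr rfl fun i _ => ?_
  rw [integral_const_mul, integral_comp_eval (X := fun _ : ι => ℝ) (μ := fun _ => gaussianReal 0 1)
    (i := i) (f := fun x : ℝ => x ^ 2) (Measurable.aestronglyMeasurable (by fun_prop)), integral_sq_gaussianReal, mul_one]

lemma variance_sum_mul_sq_gaussianPi_le {β : ι → ℝ} {B : ℝ} (hβ : ∀ i, |β i| ≤ B) :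
    Var[fun w => ∑ i, β i * w i ^ 2; gaussianPi ι] ≤
      Fintype.card ι * (B ^ 2 * Var[fun x => x ^ 2; gaussianReal 0 1]) := by
  have h := variance_sum_pi (μ := fun _ : ι => gaussianReal 0 1)
    (X := fun i x => β i * x ^ 2) (fun i => (memLp_sq_gaussianReal 2).const_mul _)
  have h' : (∑ i, fun ω : ι → ℝ => β i * ω i ^ 2) = fun w => ∑ i, β i * w i ^ 2 := by
    ext w
    simp
  rw [h'] at h
  rw [h, ← nsmul_eq_mul, ← Finset.card_univ]
  refine Finset.sum_le_card_nsmul _ _ _ fun i _ => ?_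
  rw [variance_const_mul]
  refine mul_le_mul_of_nonneg_right ?_ (variance_nonneg _ _)
  exact sq_le_sq.2 ((hβ i).trans (le_abs_self B))

lemma integrable_rpow_sum_mul_sq_gaussianPi {β : ι → ℝ} (hβ : ∀ i, 0 ≤ β i) {γ : ℝ}
    (hγ : 0 ≤ γ) :
    Integrable (fun w : ι → ℝ => (∑ i, β i * w i ^ 2) ^ γ) (gaussianPi ι) := by
  have hS : ∀ w : ι → ℝ, 0 ≤ ∑ i, β i * w i ^ 2 := fun w =>
    Finset.sum_nonneg fun i _ => mul_nonneg (hβ i) (sq_nonneg _)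
  have h := (memLp_sum_mul_sq_gaussianPi β (⌈γ⌉₊ + 1)).integrable_norm_pow (by omega)
  refine ((integrable_const 1).add h).mono' (Measurable.aestronglyMeasurable (by fun_prop))
    (ae_of_all _ fun w => ?_)
  rw [Real.norm_of_nonneg (Real.rpow_nonneg (hS w) _)]
  simp only [Pi.add_apply, Real.norm_of_nonneg (hS w)]
  exact rpow_le_one_add_pow (hS w) hγ (by push_cast; linarith [Nat.le_ceil γ])

end

/-- The power mean inequality moves the power inside the average, which leaves a bound independent
of `d`. -/
lemma integral_mean_pow_gaussianPi_le {d : ℕ} (hd : 0 < d) {β : Fin d → ℝ} {B : ℝ}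
    (hβ : ∀ i, 0 ≤ β i) (hB : ∀ i, β i ≤ B) (n : ℕ) :
    ∫ w, (1 / (d : ℝ) * ∑ i, β i * w i ^ 2) ^ n ∂(gaussianPi (Fin d)) ≤
      B ^ n * ∫ x, x ^ (2 * n) ∂(gaussianReal 0 1) := by
  have hd' : (0 : ℝ) < d := by exact_mod_cast hd
  have hint : Integrable (fun x : ℝ => x ^ (2 * n)) (gaussianReal 0 1) := by
    rcases eq_or_ne n 0 with rfl | hn
    · simp
    refine (memLp_sq_gaussianReal n).integrable_norm_pow hn |>.congr (ae_of_all _ fun x => ?_)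
    simp [pow_mul]
  have hint' : ∀ i : Fin d, Integrable (fun w : Fin d → ℝ => w i ^ (2 * n))
      (gaussianPi (Fin d)) := fun i => integrable_comp_eval hint
  have hB0 : 0 ≤ B := (hβ ⟨0, hd⟩).trans (hB _)
  calc ∫ w, (1 / (d : ℝ) * ∑ i, β i * w i ^ 2) ^ n ∂(gaussianPi (Fin d))
      ≤ ∫ w, ∑ i : Fin d, 1 / (d : ℝ) * (B ^ n * w i ^ (2 * n)) ∂(gaussianPi (Fin d)) := by
        refine integral_mono_of_nonneg (ae_of_all _ fun w => ?_)
          (integrable_finsetSum _ fun i _ => ((hint' i).const_mul _).const_mul _)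
          (ae_of_all _ fun w => ?_)
        · have : 0 ≤ ∑ i, β i * w i ^ 2 :=
            Finset.sum_nonneg fun i _ => mul_nonneg (hβ i) (sq_nonneg _)
          simp only [Pi.zero_apply]
          positivity
        · simp only
          rw [Finset.mul_sum]
          refine (Real.pow_arith_mean_le_arith_mean_pow Finset.univ (fun _ : Fin d => 1 / (d : ℝ))
            (fun i => β i * w i ^ 2) (fun _ _ => by positivity)
            (by simp [hd'.ne']) (fun i _ => mul_nonneg (hβ i) (sq_nonneg _)) n).trans ?_
          refine Finset.sum_le_sum fun i _ => ?_
          rw [mul_pow, ← pow_mul]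
          have h1 := pow_le_pow_left₀ (hβ i) (hB i) n
          have h2 : 0 ≤ w i ^ (2 * n) := by rw [pow_mul]; positivity
          gcongr
    _ = B ^ n * ∫ x, x ^ (2 * n) ∂(gaussianReal 0 1) := by
        rw [integral_finsetSum _ fun i _ => ((hint' i).const_mul _).const_mul _]
        simp_rw [integral_const_mul, fun i : Fin d => integral_comp_eval (i := i)
          (μ := fun _ : Fin d => gaussianReal 0 1) (f := fun x : ℝ => x ^ (2 * n))
          hint.aestronglyMeasurable]
        simp only [Finset.sum_const, Finset.card_univ, Fintype.card_fin, nsmul_eq_mul]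
        field_simp

/-- Powers of averages of independent squared Gaussians with bounded weights concentrate. -/
lemma exists_integral_rpow_mean_le {γ : ℝ} (hγ : 1 ≤ γ) (B : ℝ) :
    ∃ K : ℝ, ∀ d : ℕ, 0 < d → ∀ β : Fin d → ℝ, (∀ i, 0 ≤ β i) → (∀ i, β i ≤ B) →
      ∫ w, (1 / (d : ℝ) * ∑ i, β i * w i ^ 2) ^ γ ∂(gaussianPi (Fin d)) ≤
        (1 / (d : ℝ) * ∑ i, β i) ^ γ + K / √d := by
  -- An integer exponent above `2 * (γ - 1)`, so that the square of the tangent slope is at most `1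
  -- + S ^ n`; the extra one keeps `n` nonzero.
  set n : ℕ := ⌈2 * (γ - 1)⌉₊ + 1 with hn
  set M : ℝ := ∫ x, x ^ (2 * n) ∂(gaussianReal 0 1) with hM
  set V : ℝ := Var[fun x => x ^ 2; gaussianReal 0 1] with hV
  refine ⟨1 + B ^ n * M + γ ^ 2 / 4 * (B ^ 2 * V), fun d hd β hβ hB => ?_⟩
  have hd' : (0 : ℝ) < d := by exact_mod_cast hd
  have hsq : (0 : ℝ) < √d := Real.sqrt_pos.2 hd'
  set S : (Fin d → ℝ) → ℝ := fun w => 1 / (d : ℝ) * ∑ i, β i * w i ^ 2 with hS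
  set s : ℝ := 1 / (d : ℝ) * ∑ i, β i with hs
  have hS0 : ∀ w, 0 ≤ S w := fun w => mul_nonneg (by positivity)
    (Finset.sum_nonneg fun i _ => mul_nonneg (hβ i) (sq_nonneg _))
  have hs0 : 0 ≤ s := mul_nonneg (by positivity) (Finset.sum_nonneg fun i _ => hβ i)
  have hL : ∀ m : ℕ, MemLp S m (gaussianPi (Fin d)) := fun m =>
    (memLp_sum_mul_sq_gaussianPi β m).const_mul _
  have hmean : ∫ w, S w ∂(gaussianPi (Fin d)) = s := by
    rw [hS, integral_const_mul, integral_sum_mul_sq_gaussianPi]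
  have hvar : ∫ w, (S w - s) ^ 2 ∂(gaussianPi (Fin d)) ≤ B ^ 2 * V / d := by
    have h1 : Var[S; gaussianPi (Fin d)] ≤ B ^ 2 * V / d := by
      rw [hS, variance_const_mul]
      have h2 := variance_sum_mul_sq_gaussianPi_le (β := β) (B := B)
        (fun i => by rw [abs_of_nonneg (hβ i)]; exact hB i)
      rw [Fintype.card_fin] at h2
      calc _ ≤ (1 / (d : ℝ)) ^ 2 * (d * (B ^ 2 * V)) := by gcongr
        _ = _ := by field_simp
    rwa [variance_eq_integral (hL 1).1.aemeasurable, hmean] at h1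
  have hSn : Integrable (fun w => S w ^ n) (gaussianPi (Fin d)) := by
    refine ((hL n).integrable_norm_pow (by omega)).congr (ae_of_all _ fun w => ?_)
    simp only [Real.norm_of_nonneg (hS0 w)]
  have hSs : Integrable (fun w => (S w - s) ^ 2) (gaussianPi (Fin d)) :=
    ((hL 2).sub (memLp_const s)).integrable_sq
  have hpt : ∀ w, S w ^ γ ≤ s ^ γ + ((1 / √d) * (1 + S w ^ n) +
      γ ^ 2 / 4 * √d * (S w - s) ^ 2) := by
    intro w
    -- The tangent is taken at the random point `S w` and evaluated at the mean `s`, which bounds `S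
    -- w ^ γ` from above. The error `γ * S ^ (γ - 1) * (S - s)` is then split by Young's inequality
    -- with weight `√d`: as the variance is `O(1 / d)`, both halves have expectation `O(1 / √d)`.
    have h1 := rpow_add_mul_sub_le_rpow hγ (hS0 w) hs0
    have h2 : (S w ^ (γ - 1)) ^ 2 ≤ 1 + S w ^ n := by
      rw [← Real.rpow_natCast, ← Real.rpow_mul (hS0 w)]
      refine rpow_le_one_add_pow (hS0 w) (by push_cast; linarith) ?_
      rw [hn]
      push_cast
      linarith [Nat.le_ceil (2 * (γ - 1))]
    have h3 : γ * S w ^ (γ - 1) * (S w - s) ≤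
        (1 / √d) * (S w ^ (γ - 1)) ^ 2 + γ ^ 2 / 4 * √d * (S w - s) ^ 2 := by
      have h4 : 0 ≤ (1 / √d) * (S w ^ (γ - 1) - γ / 2 * √d * (S w - s)) ^ 2 := by positivity
      have h5 : (1 / √d) * (S w ^ (γ - 1) - γ / 2 * √d * (S w - s)) ^ 2 =
        (1 / √d) * (S w ^ (γ - 1)) ^ 2 + γ ^ 2 / 4 * √d * (S w - s) ^ 2
          - γ * S w ^ (γ - 1) * (S w - s) := by
        field_simp
        ring
      linarith
    have h6 : (1 / √d) * (S w ^ (γ - 1)) ^ 2 ≤ (1 / √d) * (1 + S w ^ n) := by gcongr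
    linarith
  have hI1 : Integrable (fun w => (1 / √d) * (1 + S w ^ n)) (gaussianPi (Fin d)) :=
    ((integrable_const 1).add hSn).const_mul _
  have hI2 : Integrable (fun w => γ ^ 2 / 4 * √d * (S w - s) ^ 2) (gaussianPi (Fin d)) :=
    hSs.const_mul _
  have hI3 : Integrable (fun w => (1 / √d) * (1 + S w ^ n) + γ ^ 2 / 4 * √d * (S w - s) ^ 2)
    (gaussianPi (Fin d)) := hI1.add hI2
  calc ∫ w, S w ^ γ ∂(gaussianPi (Fin d))
      ≤ ∫ w, (s ^ γ + ((1 / √d) * (1 + S w ^ n) +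
          γ ^ 2 / 4 * √d * (S w - s) ^ 2)) ∂(gaussianPi (Fin d)) :=
        integral_mono_of_nonneg (ae_of_all _ fun w => Real.rpow_nonneg (hS0 w) _)
          ((integrable_const _).add hI3) (ae_of_all _ hpt)
    _ = s ^ γ + ((1 / √d) * (1 + ∫ w, S w ^ n ∂(gaussianPi (Fin d))) +
          γ ^ 2 / 4 * √d * ∫ w, (S w - s) ^ 2 ∂(gaussianPi (Fin d))) := by
        rw [integral_add (integrable_const _) hI3, integral_add hI1 hI2,
          integral_const_mul, integral_const_mul, integral_add (integrable_const _) hSn]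
        simp
    _ ≤ s ^ γ + ((1 / √d) * (1 + B ^ n * M) + γ ^ 2 / 4 * √d * (B ^ 2 * V / d)) := by
        have := integral_mean_pow_gaussianPi_le hd hβ hB n
        gcongr
    _ = s ^ γ + (1 + B ^ n * M + γ ^ 2 / 4 * (B ^ 2 * V)) / √d := by
        have h7 : √d / (d : ℝ) = 1 / √d := by
          rw [div_eq_div_iff hd'.ne' hsq.ne', Real.mul_self_sqrt hd'.le, one_mul]
        have : √d * (B ^ 2 * V / d) = (B ^ 2 * V) * (1 / √d) := by rw [← h7]; ring
        rw [mul_assoc (γ ^ 2 / 4), this]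
        ring

/-! ### Two-sided bounds for the log-partition function -/

/-- Gibbs variational lower bound for log-partition functions. -/
lemma log_integral_exp_add_integral_tilted_le {Ω : Type*} [MeasurableSpace Ω] (μ : Measure Ω)
    [NeZero μ] {g H : Ω → ℝ} (hg : Integrable (fun x => Real.exp (g x)) μ)
    (hH : Integrable (fun x => Real.exp (H x)) μ)
    (hHg : Integrable (fun x => H x - g x) (μ.tilted g)) :
    Real.log (∫ x, Real.exp (g x) ∂μ) + ∫ x, (H x - g x) ∂(μ.tilted g) ≤
      Real.log (∫ x, Real.exp (H x) ∂μ) := by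
  have := isProbabilityMeasure_tilted hg
  have hpos : 0 < ∫ x, Real.exp (g x) ∂μ := integral_exp_pos hg
  have hpos' : 0 < ∫ x, Real.exp (H x) ∂μ := integral_exp_pos hH
  have h1 : ∫ x, Real.exp (H x - g x) ∂(μ.tilted g) =
      (∫ x, Real.exp (H x) ∂μ) / ∫ x, Real.exp (g x) ∂μ := by
    rw [integral_exp_tilted]
    congr 2
    ext x
    simp
  have h2 : Integrable (fun x => Real.exp (H x - g x)) (μ.tilted g) := by
    rw [integrable_tilted_iff hg]
    refine hH.congr (ae_of_all _ fun x => ?_)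
    simp only [smul_eq_mul]
    rw [← Real.exp_add, add_sub_cancel]
  -- Jensen under the tilted measure, where the mean of `exp (H - g)` is the ratio of the two
  -- partition functions.
  have h3 := convexOn_exp.map_integral_le Real.continuous_exp.continuousOn isClosed_univ
    (ae_of_all _ fun _ => mem_univ _) hHg h2
  rw [h1] at h3
  have h4 := (Real.le_log_iff_exp_le (by positivity)).2 h3
  rw [Real.log_div hpos'.ne' hpos.ne'] at h4
  linarith

lemma log_integral_exp_le_add {Ω : Type*} [MeasurableSpace Ω] (μ : Measure Ω)
    [NeZero μ] {g H : Ω → ℝ} {A : ℝ} (hg : Integrable (fun x => Real.exp (g x)) μ)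
    (hH : Integrable (fun x => Real.exp (H x)) μ) (hle : ∀ x, H x ≤ A + g x) :
    Real.log (∫ x, Real.exp (H x) ∂μ) ≤ A + Real.log (∫ x, Real.exp (g x) ∂μ) := by
  have hpos : 0 < ∫ x, Real.exp (g x) ∂μ := integral_exp_pos hg
  rw [← Real.log_exp A, ← Real.log_mul (by positivity) hpos.ne', ← integral_const_mul]
  refine Real.log_le_log (integral_exp_pos hH) (integral_mono hH (hg.const_mul _) fun x => ?_)
  simp only
  rw [← Real.exp_add]
  exact Real.exp_le_exp.2 (hle x)

section

variable {ι : Type*} [Fintype ι]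

/-- The squared distance of the images of `z` and `y` under the diagonal matrix with entries
`√(c i)`. -/
noncomputable def weightedSqDist (c z y : ι → ℝ) : ℝ := ∑ i, c i * (z i - y i) ^ 2

lemma weightedSqDist_nonneg {c : ι → ℝ} (hc : ∀ i, 0 ≤ c i) (z y : ι → ℝ) :
    0 ≤ weightedSqDist c z y :=
  Finset.sum_nonneg fun i _ => mul_nonneg (hc i) (sq_nonneg _)

@[fun_prop]
lemma measurable_weightedSqDist (c : ι → ℝ) :
    Measurable fun p : (ι → ℝ) × (ι → ℝ) => weightedSqDist c p.1 p.2 := by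
  unfold weightedSqDist
  fun_prop

/-- The variance of the `i`-th coordinate after tilting by `exp (-t/2 * |x - y|²)`. -/
noncomputable def tiltedVar (t c : ℝ) : ℝ := c / (1 + t * c) + c / (1 + t * c) ^ 2

lemma tiltedVar_nonneg {t c : ℝ} (ht : 0 ≤ t) (hc : 0 ≤ c) : 0 ≤ tiltedVar t c := by
  unfold tiltedVar
  positivity

/-- Uniformity in `c` is the point: eigenvalues may be unbounded, yet the concentration estimate
only sees weights bounded by `2 / t`. -/
lemma tiltedVar_le {t c : ℝ} (ht : 0 < t) (hc : 0 ≤ c) : tiltedVar t c ≤ 2 / t := by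
  have h1 : c / (1 + t * c) ≤ 1 / t := by
    rw [div_le_div_iff₀ (by positivity) ht]
    linarith
  have h2 : c / (1 + t * c) ^ 2 ≤ c / (1 + t * c) := by
    apply div_le_div_of_nonneg_left hc (by positivity)
    have : 0 ≤ t * c := by positivity
    nlinarith
  unfold tiltedVar
  have : 2 / t = 1 / t + 1 / t := by ring
  linarith

lemma integrable_exp_neg_weightedSqDist {c : ι → ℝ} (hc : ∀ i, 0 ≤ c i) {t : ℝ} (ht : 0 ≤ t)
    (z : ι → ℝ) :
    Integrable (fun y => Real.exp (-(t / 2 * weightedSqDist c z y))) (gaussianPi ι) := by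
  refine Integrable.of_bound (Measurable.aestronglyMeasurable (by fun_prop)) 1
    (ae_of_all _ fun y => ?_)
  rw [Real.norm_eq_abs, Real.abs_exp, Real.exp_le_one_iff]
  have := weightedSqDist_nonneg hc z y
  have : 0 ≤ t / 2 * weightedSqDist c z y := by positivity
  linarith

lemma integrable_exp_neg_rpow_weightedSqDist {c : ι → ℝ} (hc : ∀ i, 0 ≤ c i) {a : ℝ} (ha : 0 ≤ a)
    (γ : ℝ) (z : ι → ℝ) :
    Integrable (fun y => Real.exp (-(a * weightedSqDist c z y ^ γ))) (gaussianPi ι) := by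
  refine Integrable.of_bound (Measurable.aestronglyMeasurable (by fun_prop)) 1
    (ae_of_all _ fun y => ?_)
  rw [Real.norm_eq_abs, Real.abs_exp, Real.exp_le_one_iff]
  have := Real.rpow_nonneg (weightedSqDist_nonneg hc z y) γ
  have : 0 ≤ a * weightedSqDist c z y ^ γ := by positivity
  linarith

lemma neg_mul_weightedSqDist (t : ℝ) (c z y : ι → ℝ) :
    -(t / 2 * weightedSqDist c z y) = ∑ i, -(t * c i / 2 * (z i - y i) ^ 2) := by
  rw [weightedSqDist, Finset.mul_sum, ← Finset.sum_neg_distrib]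
  refine Finset.sum_congr rfl fun i _ => ?_
  ring

lemma log_integral_exp_neg_weightedSqDist {c : ι → ℝ} (hc : ∀ i, 0 ≤ c i) {t : ℝ} (ht : 0 ≤ t)
    (z : ι → ℝ) :
    Real.log (∫ y, Real.exp (-(t / 2 * weightedSqDist c z y)) ∂(gaussianPi ι)) =
      -(1 / 2) * (∑ i, Real.log (1 + t * c i)) -
        ∑ i, t * c i / (2 * (1 + t * c i)) * z i ^ 2 := by
  simp_rw [neg_mul_weightedSqDist]
  rw [log_integral_gaussianPi_exp_neg_sq (fun i => t * c i) z
    (fun i => mul_nonneg ht (hc i)), Finset.sum_sub_distrib, ← Finset.mul_sum]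

lemma integrable_log_integral_exp_neg_weightedSqDist {c : ι → ℝ} (hc : ∀ i, 0 ≤ c i) {t : ℝ}
    (ht : 0 ≤ t) :
    Integrable (fun z => Real.log
      (∫ y, Real.exp (-(t / 2 * weightedSqDist c z y)) ∂(gaussianPi ι))) (gaussianPi ι) := by
  simp_rw [log_integral_exp_neg_weightedSqDist hc ht]
  exact (integrable_const _).sub (integrable_sum_mul_sq_gaussianPi _)

lemma integral_log_integral_exp_neg_weightedSqDist {c : ι → ℝ} (hc : ∀ i, 0 ≤ c i) {t : ℝ}
    (ht : 0 ≤ t) :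
    ∫ z, Real.log (∫ y, Real.exp (-(t / 2 * weightedSqDist c z y)) ∂(gaussianPi ι))
      ∂(gaussianPi ι) =
      -(1 / 2) * (∑ i, Real.log (1 + t * c i)) - 1 / 2 * ∑ i, t * c i / (1 + t * c i) := by
  simp_rw [log_integral_exp_neg_weightedSqDist hc ht]
  rw [integral_sub (integrable_const _) (integrable_sum_mul_sq_gaussianPi _),
    integral_sum_mul_sq_gaussianPi]
  simp only [integral_const, probReal_univ, one_smul, Finset.mul_sum]
  congr 1
  refine Finset.sum_congr rfl fun i _ => ?_
  rw [div_mul_eq_div_div_swap]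
  ring

/-- Subtracting the tilted mean from `z i` leaves `z i / (1 + t * c i)`, so the displacement is a
combination of the independent variables `z i` and `w i`. -/
lemma weightedSqDist_tilted {c : ι → ℝ} (hc : ∀ i, 0 ≤ c i) {t : ℝ} (ht : 0 ≤ t)
    (z w : ι → ℝ) :
    weightedSqDist c z (fun i => t * c i * z i / (1 + t * c i) + 1 / √(1 + t * c i) * w i) =
      ∑ i, c i * (1 / (1 + t * c i) * z i + -(1 / √(1 + t * c i)) * w i) ^ 2 := by
  unfold weightedSqDist
  refine Finset.sum_congr rfl fun i _ => ?_
  have : 0 < 1 + t * c i := by have := mul_nonneg ht (hc i); linarith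
  congr 2
  have h : z i = 1 / (1 + t * c i) * z i + t * c i * z i / (1 + t * c i) := by
    field_simp
  nth_rw 1 [h]
  ring

/-- Integration against the law of `(z, y)` with `z` Gaussian and `y` sampled from the tilted
measure. -/
lemma integral_tilted_weightedSqDist {c : ι → ℝ} (hc : ∀ i, 0 ≤ c i) {t : ℝ} (ht : 0 ≤ t)
    {φ : ℝ → ℝ} (hφ : Measurable φ)
    (hint : Integrable (fun w : ι → ℝ => φ (∑ i, tiltedVar t (c i) * w i ^ 2)) (gaussianPi ι)) :
    (∀ᵐ z ∂(gaussianPi ι), Integrable (fun y => φ (weightedSqDist c z y))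
      ((gaussianPi ι).tilted fun y => -(t / 2 * weightedSqDist c z y))) ∧
    Integrable (fun z => ∫ y, φ (weightedSqDist c z y)
      ∂((gaussianPi ι).tilted fun y => -(t / 2 * weightedSqDist c z y))) (gaussianPi ι) ∧
    ∫ z, ∫ y, φ (weightedSqDist c z y)
      ∂((gaussianPi ι).tilted fun y => -(t / 2 * weightedSqDist c z y)) ∂(gaussianPi ι) =
      ∫ w, φ (∑ i, tiltedVar t (c i) * w i ^ 2) ∂(gaussianPi ι) := by
  have hpos : ∀ i, 0 < 1 + t * c i := fun i => by have := mul_nonneg ht (hc i); linarith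
  have htilt : ∀ z : ι → ℝ, ((gaussianPi ι).tilted fun y => -(t / 2 * weightedSqDist c z y)) =
      (gaussianPi ι).map
        (fun w i => t * c i * z i / (1 + t * c i) + 1 / √(1 + t * c i) * w i) := by
    intro z
    simp_rw [neg_mul_weightedSqDist]
    exact gaussianPi_tilted_sq (fun i => t * c i) z (fun i => mul_nonneg ht (hc i))
  set a : ι → ℝ := fun i => 1 / (1 + t * c i)
  set b : ι → ℝ := fun i => -(1 / √(1 + t * c i))
  -- Standard deviation of `a i * z i + b i * w i`: the first term comes from the spread of `z`, the
  -- second from the tilted measure. Multiplying `s i ^ 2` by `c i` gives `tiltedVar t (c i)`.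
  set s : ι → ℝ := fun i => √(1 / (1 + t * c i) ^ 2 + 1 / (1 + t * c i))
  have hs : ∀ i, s i ^ 2 = 1 / (1 + t * c i) ^ 2 + 1 / (1 + t * c i) := fun i =>
    Real.sq_sqrt (by have := hpos i; positivity)
  have hmap := gaussianPi_prod_map_add a b s fun i => by
    rw [hs, neg_sq, div_pow, div_pow, Real.sq_sqrt (hpos i).le, one_pow]
  have hF : Measurable fun x : ι → ℝ => φ (∑ i, c i * x i ^ 2) := by fun_prop
  have hM1 : Measurable fun (p : (ι → ℝ) × (ι → ℝ)) i => a i * p.1 i + b i * p.2 i := by fun_prop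
  have hM2 : Measurable fun (w : ι → ℝ) i => s i * w i := by fun_prop
  have hv : (fun w : ι → ℝ => φ (∑ i, tiltedVar t (c i) * w i ^ 2)) =
      fun w => (fun x : ι → ℝ => φ (∑ i, c i * x i ^ 2)) (fun i => s i * w i) := by
    ext w
    simp only
    congr 1
    refine Finset.sum_congr rfl fun i _ => ?_
    rw [mul_pow, hs, tiltedVar]
    ring
  have hprod : Integrable (fun p : (ι → ℝ) × (ι → ℝ) =>
      φ (∑ i, c i * (a i * p.1 i + b i * p.2 i) ^ 2)) ((gaussianPi ι).prod (gaussianPi ι)) := by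
    rw [hv] at hint
    have h1 := (integrable_map_measure hF.aestronglyMeasurable hM2.aemeasurable).2 hint
    rw [← hmap] at h1
    exact (integrable_map_measure hF.aestronglyMeasurable hM1.aemeasurable).1 h1
  have hmeas : ∀ z : ι → ℝ, Measurable fun y => φ (weightedSqDist c z y) := fun z => by fun_prop
  have hMz : ∀ z : ι → ℝ, Measurable fun (w : ι → ℝ) i =>
      t * c i * z i / (1 + t * c i) + 1 / √(1 + t * c i) * w i := fun z => by fun_prop
  have hinner : ∀ z, ∫ y, φ (weightedSqDist c z y)
      ∂((gaussianPi ι).tilted fun y => -(t / 2 * weightedSqDist c z y)) =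
      ∫ w, φ (∑ i, c i * (a i * z i + b i * w i) ^ 2) ∂(gaussianPi ι) := by
    intro z
    rw [htilt, integral_map (hMz z).aemeasurable (hmeas z).aestronglyMeasurable]
    simp_rw [weightedSqDist_tilted hc ht]
    rfl
  refine ⟨?_, ?_, ?_⟩
  · filter_upwards [hprod.prod_right_ae] with z hz
    rw [htilt, integrable_map_measure (hmeas z).aestronglyMeasurable (hMz z).aemeasurable]
    refine hz.congr (ae_of_all _ fun w => ?_)
    simp only [Function.comp, weightedSqDist_tilted hc ht]
    rfl
  · simp_rw [hinner]
    exact hprod.integral_prod_left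
  · simp_rw [hinner]
    rw [← integral_prod (fun p : (ι → ℝ) × (ι → ℝ) =>
      φ (∑ i, c i * (a i * p.1 i + b i * p.2 i) ^ 2)) hprod, hv,
      ← integral_map hM2.aemeasurable hF.aestronglyMeasurable, ← hmap,
      integral_map hM1.aemeasurable hF.aestronglyMeasurable]

/-- The logarithm of the average of `exp (-a * |x - y|^(2γ))` over `y`. -/
noncomputable def logPowerMoment (c : ι → ℝ) (a γ : ℝ) (z : ι → ℝ) : ℝ :=
  Real.log (∫ y, Real.exp (-(a * weightedSqDist c z y ^ γ)) ∂(gaussianPi ι))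

lemma measurable_logPowerMoment (c : ι → ℝ) (a γ : ℝ) : Measurable (logPowerMoment c a γ) := by
  unfold logPowerMoment
  refine Real.measurable_log.comp ?_
  have : StronglyMeasurable (fun p : (ι → ℝ) × (ι → ℝ) =>
      Real.exp (-(a * weightedSqDist c p.1 p.2 ^ γ))) :=
    Measurable.stronglyMeasurable (by fun_prop)
  exact this.integral_prod_right.measurable

lemma logPowerMoment_nonpos {c : ι → ℝ} (hc : ∀ i, 0 ≤ c i) {a : ℝ} (ha : 0 ≤ a) (γ : ℝ)
    (z : ι → ℝ) : logPowerMoment c a γ z ≤ 0 := by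
  have h := log_integral_exp_le_add (gaussianPi ι) (g := fun _ => 0) (A := 0) (by simp)
    (integrable_exp_neg_rpow_weightedSqDist hc ha γ z) (fun y => by
      have := Real.rpow_nonneg (weightedSqDist_nonneg hc z y) γ
      have : 0 ≤ a * weightedSqDist c z y ^ γ := by positivity
      linarith)
  simpa [logPowerMoment] using h

/-- Gibbs' bound with the quadratically tilted trial measure, for each `z`; `R z` is the trial
average of the difference of exponents. It is only almost sure because integrability for fixed `z`
comes from Fubini. -/
lemma ae_le_logPowerMoment {c : ι → ℝ} (hc : ∀ i, 0 ≤ c i) {a : ℝ} (ha : 0 ≤ a) {γ : ℝ}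
    (hγ : 0 ≤ γ) {t : ℝ} (ht : 0 ≤ t) :
    ∃ R : (ι → ℝ) → ℝ, Integrable R (gaussianPi ι) ∧
      (∫ z, R z ∂(gaussianPi ι) = t / 2 * (∑ i, tiltedVar t (c i)) -
        a * ∫ w, (∑ i, tiltedVar t (c i) * w i ^ 2) ^ γ ∂(gaussianPi ι)) ∧
      ∀ᵐ z ∂(gaussianPi ι),
        Real.log (∫ y, Real.exp (-(t / 2 * weightedSqDist c z y)) ∂(gaussianPi ι)) + R z ≤
          logPowerMoment c a γ z := by
  have hI1 : Integrable (fun w : ι → ℝ => t / 2 * ∑ i, tiltedVar t (c i) * w i ^ 2)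
    (gaussianPi ι) := (integrable_sum_mul_sq_gaussianPi _).const_mul _
  have hI2 : Integrable (fun w : ι → ℝ => a * (∑ i, tiltedVar t (c i) * w i ^ 2) ^ γ)
    (gaussianPi ι) := (integrable_rpow_sum_mul_sq_gaussianPi
      (fun i => tiltedVar_nonneg ht (hc i)) hγ).const_mul _
  obtain ⟨h1, h2, h3⟩ := integral_tilted_weightedSqDist hc ht
    (φ := fun q => t / 2 * q - a * q ^ γ) (by fun_prop) (hI1.sub hI2)
  refine ⟨_, h2, ?_, ?_⟩
  · rw [h3, integral_sub hI1 hI2, integral_const_mul, integral_const_mul,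
      integral_sum_mul_sq_gaussianPi]
  · filter_upwards [h1] with z hz
    have := log_integral_exp_add_integral_tilted_le (gaussianPi ι)
      (integrable_exp_neg_weightedSqDist hc ht z)
      (integrable_exp_neg_rpow_weightedSqDist hc ha γ z)
      (hz.congr (ae_of_all _ fun y => by simp only; ring))
    refine le_trans (le_of_eq ?_) this
    congr 2
    ext y
    ring

lemma integrable_logPowerMoment {c : ι → ℝ} (hc : ∀ i, 0 ≤ c i) {a : ℝ} (ha : 0 ≤ a) {γ : ℝ}
    (hγ : 0 ≤ γ) : Integrable (logPowerMoment c a γ) (gaussianPi ι) := by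
  -- At `t = 0` the trial measure is untilted; together with `logPowerMoment_nonpos` this squeezes
  -- the function between an integrable one and zero.
  obtain ⟨R, hR, -, hle⟩ := ae_le_logPowerMoment hc ha hγ (le_refl 0)
  refine ((integrable_log_integral_exp_neg_weightedSqDist hc le_rfl).add hR).mono
    (measurable_logPowerMoment c a γ).aestronglyMeasurable ?_
  filter_upwards [hle] with z hz
  have := logPowerMoment_nonpos hc ha γ z
  rw [Real.norm_of_nonpos this, Pi.add_apply, Real.norm_of_nonpos (hz.trans this)]
  linarith

lemma le_integral_logPowerMoment {c : ι → ℝ} (hc : ∀ i, 0 ≤ c i) {a : ℝ} (ha : 0 ≤ a) {γ : ℝ}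
    (hγ : 0 ≤ γ) {t : ℝ} (ht : 0 ≤ t) :
    -(1 / 2) * (∑ i, Real.log (1 + t * c i)) - 1 / 2 * (∑ i, t * c i / (1 + t * c i)) +
      (t / 2 * (∑ i, tiltedVar t (c i)) -
        a * ∫ w, (∑ i, tiltedVar t (c i) * w i ^ 2) ^ γ ∂(gaussianPi ι)) ≤
      ∫ z, logPowerMoment c a γ z ∂(gaussianPi ι) := by
  obtain ⟨R, hR, hRi, hle⟩ := ae_le_logPowerMoment hc ha hγ ht
  have hI := integrable_log_integral_exp_neg_weightedSqDist hc ht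
  rw [← hRi, ← integral_log_integral_exp_neg_weightedSqDist hc ht, ← integral_add hI hR]
  exact integral_mono_ae (hI.add hR) (integrable_logPowerMoment hc ha hγ) hle

/-- The tangent to `x ^ γ` at `q` lies below the curve, and `htq` identifies `a` times its slope
with `t / 2`, so the integrand is dominated by the solvable quadratic one. -/
lemma integral_logPowerMoment_le {c : ι → ℝ} (hc : ∀ i, 0 ≤ c i) {a : ℝ} (ha : 0 ≤ a) {γ : ℝ}
    (hγ : 1 ≤ γ) {t q : ℝ} (ht : 0 ≤ t) (hq : 0 ≤ q) (htq : t / 2 = a * (γ * q ^ (γ - 1))) :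
    ∫ z, logPowerMoment c a γ z ∂(gaussianPi ι) ≤
      -(a * q ^ γ) + t / 2 * q +
      (-(1 / 2) * (∑ i, Real.log (1 + t * c i)) - 1 / 2 * (∑ i, t * c i / (1 + t * c i))) := by
  have hI := integrable_log_integral_exp_neg_weightedSqDist hc ht
  have h : ∀ z, logPowerMoment c a γ z ≤ (-(a * q ^ γ) + t / 2 * q) +
      Real.log (∫ y, Real.exp (-(t / 2 * weightedSqDist c z y)) ∂(gaussianPi ι)) := by
    intro z
    refine log_integral_exp_le_add _ (integrable_exp_neg_weightedSqDist hc ht z)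
      (integrable_exp_neg_rpow_weightedSqDist hc ha γ z) fun y => ?_
    have h1 := mul_le_mul_of_nonneg_left
      (rpow_add_mul_sub_le_rpow hγ hq (weightedSqDist_nonneg hc z y)) ha
    rw [htq]
    nlinarith [h1]
  calc _ ≤ ∫ z, ((-(a * q ^ γ) + t / 2 * q) +
      Real.log (∫ y, Real.exp (-(t / 2 * weightedSqDist c z y)) ∂(gaussianPi ι)))
        ∂(gaussianPi ι) :=
        integral_mono (integrable_logPowerMoment hc ha (by linarith))
          ((integrable_const _).add hI) h
    _ = _ := by
        rw [integral_add (integrable_const _) hI,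
          integral_log_integral_exp_neg_weightedSqDist hc ht]
        simp

/-! ### Partition functions over Lebesgue measure -/

lemma integral_volume_exp_neg_sq :
    ∫ x : ι → ℝ, Real.exp (-(1 / 2 * ∑ i, x i ^ 2)) = √(2 * Real.pi) ^ Fintype.card ι := by
  have h : ∀ x : ι → ℝ, Real.exp (-(1 / 2 * ∑ i, x i ^ 2)) =
      ∏ i, Real.exp (-(x i - 0) ^ 2 / (2 * 1)) := by
    intro x
    rw [← Real.exp_sum, Finset.mul_sum, ← Finset.sum_neg_distrib]
    congr 1
    refine Finset.sum_congr rfl fun i _ => ?_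
    ring
  simp_rw [h]
  rw [integral_fintype_prod_volume_eq_pow (fun x => Real.exp (-(x - 0) ^ 2 / (2 * 1))),
    integral_exp_neg_sq_div, mul_one]

lemma integrable_volume_exp_neg_sq :
    Integrable fun x : ι → ℝ => Real.exp (-(1 / 2 * ∑ i, x i ^ 2)) :=
  not_not.1 fun h => by
    -- A non-integrable function would have integral zero by convention, against the positive value
    -- already computed.
    have h1 := integral_undef h
    rw [integral_volume_exp_neg_sq] at h1
    have : 0 < √(2 * Real.pi) ^ Fintype.card ι := by positivity
    linarith

lemma volume_tilted_eq_gaussianPi :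
    (volume : Measure (ι → ℝ)).tilted (fun x => -(1 / 2 * ∑ i, x i ^ 2)) = gaussianPi ι := by
  have h1 : gaussianReal 0 1 = (volume : Measure ℝ).tilted (fun x => -(x - 0) ^ 2 / (2 * 1)) := by
    have := gaussianReal_eq_tilted 0 1 one_pos
    simpa using this
  rw [gaussianPi, h1, pi_tilted (fun _ => volume) (fun _ x => -(x - 0) ^ 2 / (2 * 1)), ← volume_pi]
  congr 1
  ext x
  rw [Finset.mul_sum, ← Finset.sum_neg_distrib]
  refine Finset.sum_congr rfl fun i _ => ?_
  ring

/-- Tangent line at `q`, chosen so that `a` times the slope is `1 / 2`: the comparison weight is the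
standard Gaussian one. -/
lemma exp_neg_rpow_le {a γ q : ℝ} (ha : 0 ≤ a) (hγ : 1 ≤ γ) (hq : 0 ≤ q)
    (haq : 1 / 2 = a * (γ * q ^ (γ - 1))) (x : ι → ℝ) :
    -(a * (∑ i, x i ^ 2) ^ γ) ≤ (-(a * q ^ γ) + 1 / 2 * q) + -(1 / 2 * ∑ i, x i ^ 2) := by
  have h1 := mul_le_mul_of_nonneg_left
    (rpow_add_mul_sub_le_rpow hγ hq
      (Finset.sum_nonneg (s := Finset.univ) fun i _ => sq_nonneg (x i))) ha
  have h2 : a * (q ^ γ + γ * q ^ (γ - 1) * (∑ i, x i ^ 2 - q)) =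
      a * q ^ γ + 1 / 2 * (∑ i, x i ^ 2 - q) := by
    rw [haq]
    ring
  linarith

lemma integrable_volume_exp_neg_rpow {a γ q : ℝ} (ha : 0 ≤ a) (hγ : 1 ≤ γ) (hq : 0 ≤ q)
    (haq : 1 / 2 = a * (γ * q ^ (γ - 1))) :
    Integrable fun x : ι → ℝ => Real.exp (-(a * (∑ i, x i ^ 2) ^ γ)) := by
  refine (integrable_volume_exp_neg_sq.const_mul (Real.exp (-(a * q ^ γ) + 1 / 2 * q))).mono'
    (Measurable.aestronglyMeasurable (by fun_prop)) (ae_of_all _ fun x => ?_)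
  rw [Real.norm_eq_abs, Real.abs_exp, ← Real.exp_add]
  exact Real.exp_le_exp.2 (exp_neg_rpow_le ha hγ hq haq x)

lemma log_integral_volume_exp_neg_rpow_le {a γ q : ℝ} (ha : 0 ≤ a) (hγ : 1 ≤ γ) (hq : 0 ≤ q)
    (haq : 1 / 2 = a * (γ * q ^ (γ - 1))) :
    Real.log (∫ x : ι → ℝ, Real.exp (-(a * (∑ i, x i ^ 2) ^ γ))) ≤
      -(a * q ^ γ) + 1 / 2 * q + Fintype.card ι * (1 / 2 * Real.log (2 * Real.pi)) := by
  refine (log_integral_exp_le_add volume integrable_volume_exp_neg_sq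
    (integrable_volume_exp_neg_rpow ha hγ hq haq) (exp_neg_rpow_le ha hγ hq haq)).trans
    (le_of_eq ?_)
  rw [integral_volume_exp_neg_sq, Real.log_pow, Real.log_sqrt (by positivity)]
  ring

/-- Gibbs' bound with the standard Gaussian as trial measure. Here `haq` serves only to ensure
integrability of the exponential. -/
lemma le_log_integral_volume_exp_neg_rpow {a γ q : ℝ} (ha : 0 ≤ a) (hγ : 1 ≤ γ) (hq : 0 ≤ q)
    (haq : 1 / 2 = a * (γ * q ^ (γ - 1))) :
    Fintype.card ι * (1 / 2 * Real.log (2 * Real.pi)) + 1 / 2 * Fintype.card ι -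
      a * ∫ w, (∑ i, w i ^ 2) ^ γ ∂(gaussianPi ι) ≤
    Real.log (∫ x : ι → ℝ, Real.exp (-(a * (∑ i, x i ^ 2) ^ γ))) := by
  have hI1 : Integrable (fun w : ι → ℝ => 1 / 2 * ∑ i, w i ^ 2) (gaussianPi ι) := by
    simpa using (integrable_sum_mul_sq_gaussianPi (fun _ : ι => 1)).const_mul (1 / 2)
  have hI2 : Integrable (fun w : ι → ℝ => a * (∑ i, w i ^ 2) ^ γ) (gaussianPi ι) := by
    simpa using (integrable_rpow_sum_mul_sq_gaussianPi (β := fun _ : ι => 1) (γ := γ)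
      (by simp) (by linarith)).const_mul a
  have hsum : ∫ w, ∑ i, w i ^ 2 ∂(gaussianPi ι) = Fintype.card ι := by
    simpa using integral_sum_mul_sq_gaussianPi (fun _ : ι => 1)
  have h := log_integral_exp_add_integral_tilted_le volume
    (integrable_volume_exp_neg_sq (ι := ι)) (integrable_volume_exp_neg_rpow ha hγ hq haq) (by
      rw [volume_tilted_eq_gaussianPi]
      exact (hI1.sub hI2).congr (ae_of_all _ fun w => by simp only [Pi.sub_apply]; ring))
  rw [volume_tilted_eq_gaussianPi, integral_volume_exp_neg_sq, Real.log_pow,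
    Real.log_sqrt (by positivity)] at h
  refine le_trans (le_of_eq ?_) h
  have h2 : ∀ w : ι → ℝ, -(a * (∑ i, w i ^ 2) ^ γ) - -(1 / 2 * ∑ i, w i ^ 2) =
    1 / 2 * (∑ i, w i ^ 2) - a * (∑ i, w i ^ 2) ^ γ := fun w => by ring
  simp_rw [h2]
  rw [integral_sub hI1 hI2, integral_const_mul, integral_const_mul, hsum]
  ring

end

/-! ### Convergence of spectral averages -/

/-- A triangular array of nonnegative numbers with bounded averages whose empirical distributions
converge to `ν` when tested against smooth functions with compact support. -/
structure IsSpectralArray (c : ∀ d : ℕ, Fin d → ℝ) (ν : Measure ℝ) : Prop where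
  nonneg : ∀ d r, 0 ≤ c d r
  tendsto : ∀ φ : ℝ → ℝ, ContDiff ℝ (⊤ : ℕ∞) φ → HasCompactSupport φ →
    Tendsto (fun d : ℕ => (1 / (d : ℝ)) * ∑ r, φ (c d r)) atTop (𝓝 (∫ x, φ x ∂ν))
  bounded : ∃ M : ℝ, ∀ᶠ d : ℕ in atTop, (1 / (d : ℝ)) * ∑ r, c d r ≤ M

namespace IsSpectralArray

variable {c : ∀ d : ℕ, Fin d → ℝ} {ν : Measure ℝ} [IsProbabilityMeasure ν]

lemma ae_nonneg (h : IsSpectralArray c ν) : ∀ᵐ x ∂ν, 0 ≤ x := by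
  have h0 : ν (Iio 0) = 0 := by
    refine measure_null_of_locally_null _ fun x hx => ?_
    have hx' : x < 0 := hx
    -- The support has radius `-x / 2`, so it stays in the negative axis and misses every array
    -- entry.
    let χ : ContDiffBump x := ⟨-x / 4, -x / 2, by linarith, by linarith⟩
    have h1 := h.tendsto χ χ.contDiff χ.hasCompactSupport
    have h2 : ∀ d : ℕ, (1 / (d : ℝ)) * ∑ r, χ (c d r) = 0 := by
      intro d
      rw [Finset.sum_eq_zero, mul_zero]
      intro r _
      refine χ.zero_of_le_dist ?_
      have := h.nonneg d r
      change -x / 2 ≤ dist (c d r) x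
      rw [Real.dist_eq, abs_of_nonneg (by linarith)]
      linarith
    simp_rw [h2] at h1
    have h3 := tendsto_nhds_unique h1 tendsto_const_nhds
    rw [integral_eq_zero_iff_of_nonneg (fun y => χ.nonneg)
      (χ.continuous.integrable_of_hasCompactSupport χ.hasCompactSupport)] at h3
    refine ⟨Metric.closedBall x (-x / 4),
      mem_nhdsWithin_of_mem_nhds (Metric.closedBall_mem_nhds x (by linarith)), ?_⟩
    refine measure_mono_null (fun y hy => ?_) (ae_iff.1 h3)
    have : χ y = 1 := χ.one_of_mem_closedBall hy
    simp [this]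
  rw [ae_iff]
  simpa [Iio] using h0

/-- Smooth truncations of the identity are admissible tests, and their integrals inherit the bound
`M` on the averages; exhausting the line by balls gives integrability. The averages of the identity
itself need not converge to its integral, since mass may escape to infinity. -/
lemma integrable_id (h : IsSpectralArray c ν) : Integrable (fun x : ℝ => x) ν := by
  obtain ⟨M, hM⟩ := h.bounded
  refine (aecover_closedBall (x := (0 : ℝ)) (μ := ν)
    tendsto_natCast_atTop_atTop).integrable_of_integral_norm_bounded M (l := atTop)
    (φ := fun n : ℕ => Metric.closedBall (0 : ℝ) n) (fun n => ?_) ?_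
  · exact continuous_id.continuousOn.integrableOn_compact (isCompact_closedBall _ _)
  · filter_upwards [eventually_gt_atTop 0] with n hn
    have hn' : (0 : ℝ) < n := by exact_mod_cast hn
    let χ : ContDiffBump (0 : ℝ) := ⟨n, n + 1, hn', by linarith⟩
    have hcs : HasCompactSupport fun x => χ x * x := χ.hasCompactSupport.mul_right
    have hcd : ContDiff ℝ (⊤ : ℕ∞) fun x => χ x * x := χ.contDiff.mul contDiff_id
    have h1 := h.tendsto _ hcd hcs
    have h2 : ∫ x, χ x * x ∂ν ≤ M := by
      refine le_of_tendsto h1 (hM.mono fun d hd => le_trans ?_ hd)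
      refine mul_le_mul_of_nonneg_left (Finset.sum_le_sum fun r _ => ?_) (by positivity)
      exact mul_le_of_le_one_left (h.nonneg d r) χ.le_one
    refine le_trans ?_ h2
    rw [← integral_indicator Metric.isClosed_closedBall.measurableSet]
    refine integral_mono_of_nonneg (ae_of_all _ fun x => indicator_nonneg
      (fun _ _ => norm_nonneg _) _) (hcd.continuous.integrable_of_hasCompactSupport hcs) ?_
    filter_upwards [h.ae_nonneg] with x hx
    by_cases hxn : x ∈ Metric.closedBall (0 : ℝ) n
    · have : χ x = 1 := χ.one_of_mem_closedBall hxn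
      rw [indicator_of_mem hxn, this, one_mul, Real.norm_of_nonneg hx]
    · rw [indicator_of_notMem hxn]
      exact mul_nonneg χ.nonneg hx

/-- Averages over the array of functions of sublinear growth converge. -/
lemma tendsto_of_isLittleO (h : IsSpectralArray c ν) {g : ℝ → ℝ} {δ : ℝ} (hδ : 0 < δ)
    (hg : ∀ x, -δ < x → ContDiffAt ℝ (⊤ : ℕ∞) g x) (hint : Integrable g ν)
    (ho : g =o[atTop] fun x : ℝ => x) :
    Tendsto (fun d : ℕ => (1 / (d : ℝ)) * ∑ r, g (c d r)) atTop (𝓝 (∫ x, g x ∂ν)) := by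
  obtain ⟨M, hM⟩ := h.bounded
  set m : ℝ := ∫ x, x ∂ν
  have hm : 0 ≤ m := integral_nonneg_of_ae h.ae_nonneg
  rw [Metric.tendsto_atTop']
  intro ε hε
  -- The error budget has three parts: `η` for the truncated average, `η * |M|` for the array's
  -- tail, `η * m` for the tail of `ν`; they sum to `ε / 2`.
  set η : ℝ := ε / (2 * (1 + |M| + m)) with hη
  have hη0 : 0 < η := by positivity
  obtain ⟨R₀, hR₀⟩ := eventually_atTop.1 (ho.bound hη0)
  set R : ℝ := max R₀ 1
  have hR : 0 < R := lt_max_of_lt_right one_pos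
  -- This cutoff is one on `[0, R]` and supported in `[-δ / 2, R + δ / 2]`, inside the region where
  -- `g` is smooth.
  let χ : ContDiffBump (R / 2) := ⟨R / 2, R / 2 + δ / 2, by linarith, by linarith⟩
  have hχ1 : ∀ x, 0 ≤ x → x ≤ R → χ x = 1 := fun x h0 h1 => χ.one_of_mem_closedBall (by
    change dist x (R / 2) ≤ R / 2
    rw [Real.dist_eq, abs_le]
    constructor <;> linarith)
  have hcs : HasCompactSupport fun x => χ x * g x := χ.hasCompactSupport.mul_right
  have hcd : ContDiff ℝ (⊤ : ℕ∞) fun x => χ x * g x := by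
    rw [contDiff_iff_contDiffAt]
    intro x
    by_cases hx : -δ < x
    · exact χ.contDiffAt.mul (hg x hx)
    · have h1 : x ∉ tsupport χ := by
        rw [χ.tsupport_eq, Metric.mem_closedBall, not_le]
        change R / 2 + δ / 2 < dist x (R / 2)
        rw [Real.dist_eq, abs_of_nonpos (by linarith)]
        linarith
      have h2 : (fun x => χ x * g x) =ᶠ[𝓝 x] fun _ => 0 := by
        filter_upwards [notMem_tsupport_iff_eventuallyEq.1 h1] with y hy
        simp [hy]
      exact contDiffAt_const.congr_of_eventuallyEq h2
  have htail : ∀ x, 0 ≤ x → |g x - χ x * g x| ≤ η * x := by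
    intro x hx
    rcases le_total x R with hxR | hxR
    · rw [hχ1 x hx hxR, one_mul, sub_self, abs_zero]
      positivity
    · have h1 := hR₀ x ((le_max_left _ _).trans hxR)
      rw [Real.norm_eq_abs, Real.norm_of_nonneg hx] at h1
      have h2 : |1 - χ x| ≤ 1 := by
        rw [abs_le]
        constructor <;> linarith [χ.nonneg (x := x), χ.le_one (x := x)]
      calc |g x - χ x * g x| = |1 - χ x| * |g x| := by rw [← abs_mul]; congr 1; ring
        _ ≤ 1 * |g x| := by gcongr
        _ ≤ η * x := by rw [one_mul]; exact h1
  have hφint : Integrable (fun x => χ x * g x) ν :=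
    hcd.continuous.integrable_of_hasCompactSupport hcs
  have h1 : |∫ x, g x ∂ν - ∫ x, χ x * g x ∂ν| ≤ η * m := by
    rw [← integral_sub hint hφint, ← integral_const_mul]
    refine (abs_integral_le_integral_abs).trans (integral_mono_ae (hint.sub hφint).abs
      (h.integrable_id.const_mul _) ?_)
    filter_upwards [h.ae_nonneg] with x hx using htail x hx
  have hlim := (Metric.tendsto_atTop'.1 (h.tendsto _ hcd hcs)) η hη0
  obtain ⟨N, hN⟩ := hlim
  obtain ⟨N', hN'⟩ := eventually_atTop.1 hM
  refine ⟨max N N', fun d hd => ?_⟩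
  have h2 := hN d (lt_of_le_of_lt (le_max_left _ _) hd)
  have h3 := hN' d ((le_max_right _ _).trans hd.le)
  have h4 : |(1 / (d : ℝ)) * ∑ r, g (c d r) - (1 / (d : ℝ)) * ∑ r, χ (c d r) * g (c d r)| ≤
      η * |M| := by
    rw [← mul_sub, ← Finset.sum_sub_distrib, abs_mul, abs_of_nonneg (by positivity)]
    calc _ ≤ 1 / (d : ℝ) * ∑ r, η * c d r := by
          refine mul_le_mul_of_nonneg_left ?_ (by positivity)
          exact (Finset.abs_sum_le_sum_abs _ _).trans
            (Finset.sum_le_sum fun r _ => htail _ (h.nonneg d r))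
      _ = η * (1 / (d : ℝ) * ∑ r, c d r) := by rw [← Finset.mul_sum]; ring
      _ ≤ η * |M| := by
          refine mul_le_mul_of_nonneg_left (h3.trans (le_abs_self M)) hη0.le
  rw [Real.dist_eq] at h2 ⊢
  have h5 : η * (1 + |M| + m) = ε / 2 := by
    rw [hη]
    field_simp
  rw [abs_lt] at h2 ⊢
  rw [abs_le] at h1 h4
  constructor <;> nlinarith [h1.1, h1.2, h2.1, h2.2, h4.1, h4.2]

variable {t : ℝ}

lemma contDiffAt_div_one_add (ht : 0 < t) (p : ℝ) (k : ℕ) {x : ℝ} (hx : -(1 / t) < x) :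
    ContDiffAt ℝ (⊤ : ℕ∞) (fun x : ℝ => p * x / (1 + t * x) ^ k) x := by
  have : 0 < 1 + t * x := by
    have := mul_lt_mul_of_pos_left hx ht
    have h2 : t * -(1 / t) = -1 := by field_simp
    linarith
  refine ContDiffAt.div (by fun_prop) (by fun_prop) (by positivity)

end IsSpectralArray

lemma integrable_div_one_add_pow {ν : Measure ℝ} (hν : ∀ᵐ x ∂ν, 0 ≤ x)
    (hi : Integrable (fun x : ℝ => x) ν) {t : ℝ} (ht : 0 ≤ t) (k : ℕ) :
    Integrable (fun x => x / (1 + t * x) ^ k) ν := by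
  refine hi.mono (Measurable.aestronglyMeasurable (by fun_prop)) ?_
  filter_upwards [hν] with x hx
  have : 0 ≤ t * x := by positivity
  rw [Real.norm_of_nonneg (by positivity), Real.norm_of_nonneg hx]
  exact div_le_self hx (one_le_pow₀ (by linarith))

lemma integrable_tiltedVar {ν : Measure ℝ} (hν : ∀ᵐ x ∂ν, 0 ≤ x)
    (hi : Integrable (fun x : ℝ => x) ν) {t : ℝ} (ht : 0 ≤ t) :
    Integrable (fun x => tiltedVar t x) ν := by
  refine ((integrable_div_one_add_pow hν hi ht 1).add
    (integrable_div_one_add_pow hν hi ht 2)).congr (ae_of_all _ fun x => ?_)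
  simp [tiltedVar]

lemma integrable_mul_div_one_add {ν : Measure ℝ} (hν : ∀ᵐ x ∂ν, 0 ≤ x)
    (hi : Integrable (fun x : ℝ => x) ν) {t : ℝ} (ht : 0 ≤ t) :
    Integrable (fun x => t * x / (1 + t * x)) ν := by
  have := (integrable_div_one_add_pow hν hi ht 1).const_mul t
  simpa [mul_div_assoc] using this

lemma integrable_log_one_add {ν : Measure ℝ} (hν : ∀ᵐ x ∂ν, 0 ≤ x)
    (hi : Integrable (fun x : ℝ => x) ν) {t : ℝ} (ht : 0 ≤ t) :
    Integrable (fun x => Real.log (1 + t * x)) ν := by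
  refine (hi.const_mul t).mono (Measurable.aestronglyMeasurable (by fun_prop)) ?_
  filter_upwards [hν] with x hx
  have : 0 ≤ t * x := by positivity
  rw [Real.norm_of_nonneg (Real.log_nonneg (by linarith)), Real.norm_of_nonneg this]
  linarith [Real.log_le_sub_one_of_pos (by linarith : 0 < 1 + t * x)]

lemma isLittleO_of_abs_le_const {g : ℝ → ℝ} {B : ℝ} (hg : ∀ x, 0 ≤ x → |g x| ≤ B) :
    g =o[atTop] fun x : ℝ => x := by
  have h1 : g =O[atTop] fun _ => (1 : ℝ) := by
    refine IsBigO.of_bound B ?_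
    filter_upwards [eventually_ge_atTop 0] with x hx
    simpa using hg x hx
  exact h1.trans_isLittleO (isLittleO_const_id_atTop 1)

namespace IsSpectralArray

variable {c : ∀ d : ℕ, Fin d → ℝ} {ν : Measure ℝ} [IsProbabilityMeasure ν] {t : ℝ}

lemma tendsto_tiltedVar (h : IsSpectralArray c ν) (ht : 0 < t) :
    Tendsto (fun d : ℕ => (1 / (d : ℝ)) * ∑ r, tiltedVar t (c d r)) atTop
      (𝓝 (∫ x, tiltedVar t x ∂ν)) := by
  refine h.tendsto_of_isLittleO (δ := 1 / t) (by positivity) (fun x hx => ?_)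
    (integrable_tiltedVar h.ae_nonneg h.integrable_id ht.le)
    (isLittleO_of_abs_le_const (B := 2 / t) fun x hx => ?_)
  · have := (contDiffAt_div_one_add ht 1 1 hx).add (contDiffAt_div_one_add ht 1 2 hx)
    simp only [one_mul, pow_one] at this
    exact this
  · rw [abs_of_nonneg (tiltedVar_nonneg ht.le hx)]
    exact tiltedVar_le ht hx

lemma tendsto_mul_div_one_add (h : IsSpectralArray c ν) (ht : 0 < t) :
    Tendsto (fun d : ℕ => (1 / (d : ℝ)) * ∑ r, t * c d r / (1 + t * c d r)) atTop
      (𝓝 (∫ x, t * x / (1 + t * x) ∂ν)) := by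
  refine h.tendsto_of_isLittleO (g := fun x => t * x / (1 + t * x)) (δ := 1 / t) (by positivity)
    (fun x hx => ?_) (integrable_mul_div_one_add h.ae_nonneg h.integrable_id ht.le)
    (isLittleO_of_abs_le_const (B := 1) fun x hx => ?_)
  · simpa using contDiffAt_div_one_add ht t 1 hx
  · have : 0 ≤ t * x := by positivity
    rw [abs_of_nonneg (by positivity), div_le_one (by positivity)]
    linarith

lemma tendsto_log_one_add (h : IsSpectralArray c ν) (ht : 0 < t) :
    Tendsto (fun d : ℕ => (1 / (d : ℝ)) * ∑ r, Real.log (1 + t * c d r)) atTop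
      (𝓝 (∫ x, Real.log (1 + t * x) ∂ν)) := by
  refine h.tendsto_of_isLittleO (g := fun x => Real.log (1 + t * x)) (δ := 1 / t) (by positivity)
    (fun x hx => ?_) (integrable_log_one_add h.ae_nonneg h.integrable_id ht.le) ?_
  · have : 0 < 1 + t * x := by
      have := mul_lt_mul_of_pos_left hx ht
      have h2 : t * -(1 / t) = -1 := by field_simp
      linarith
    exact ContDiffAt.log (by fun_prop) this.ne'
  · have h1 : Tendsto (fun x : ℝ => 1 + t * x) atTop atTop :=
      tendsto_atTop_add_const_left _ _ (tendsto_id.const_mul_atTop ht)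
    have h2 := Real.isLittleO_log_id_atTop.comp_tendsto h1
    refine h2.trans_isBigO ?_
    exact ((isLittleO_const_id_atTop (1 : ℝ)).isBigO).add ((isBigO_refl _ _).const_mul_left t)

end IsSpectralArray

/-! ### Saddle-point equations and stationarity -/

/-- Differentiation under the integral sign within a set, for a Lipschitz family. -/
lemma hasDerivWithinAt_integral_of_lipschitz {Ω : Type*} [MeasurableSpace Ω] {ν : Measure Ω}
    {F : ℝ → Ω → ℝ} {F' B : Ω → ℝ} {s : Set ℝ} {t₀ : ℝ} (ht₀ : t₀ ∈ s)
    (hint : ∀ t ∈ s, Integrable (F t) ν) (hB : Integrable B ν)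
    (hlip : ∀ᵐ x ∂ν, ∀ t ∈ s, |F t x - F t₀ x| ≤ B x * |t - t₀|)
    (hF' : ∀ᵐ x ∂ν, HasDerivWithinAt (fun t => F t x) (F' x) s t₀) :
    HasDerivWithinAt (fun t => ∫ x, F t x ∂ν) (∫ x, F' x ∂ν) s t₀ := by
  rw [hasDerivWithinAt_iff_tendsto_slope]
  have h1 : ∀ᶠ t in 𝓝[s \ {t₀}] t₀, t ∈ s \ {t₀} := self_mem_nhdsWithin
  have h2 : Tendsto (fun t => ∫ x, slope (fun t => F t x) t₀ t ∂ν) (𝓝[s \ {t₀}] t₀)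
      (𝓝 (∫ x, F' x ∂ν)) := by
    refine tendsto_integral_filter_of_dominated_convergence B ?_ ?_ hB ?_
    · filter_upwards [h1] with t ht
      simp only [slope, vsub_eq_sub, smul_eq_mul]
      exact (((hint t ht.1).sub (hint t₀ ht₀)).const_mul _).aestronglyMeasurable
    · filter_upwards [h1] with t ht
      filter_upwards [hlip] with x hx
      have h3 : 0 < |t - t₀| := abs_pos.2 (sub_ne_zero.2 ht.2)
      simp only [slope, vsub_eq_sub, smul_eq_mul]
      rw [Real.norm_eq_abs, abs_mul, abs_inv, inv_mul_le_iff₀ h3, mul_comm]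
      exact hx t ht.1
    · filter_upwards [hF'] with x hx
      exact hasDerivWithinAt_iff_tendsto_slope.1 hx
  refine h2.congr' ?_
  filter_upwards [h1] with t ht
  simp only [slope, vsub_eq_sub, smul_eq_mul]
  rw [integral_const_mul, integral_sub (hint t ht.1) (hint t₀ ht₀)]

lemma hasDerivAt_fGamma {γ : ℝ} (hγ : 1 ≤ γ) (u : ℝ) :
    HasDerivAt (fGamma γ) (u ^ (γ - 1) / 2) u := by
  have h := (Real.hasDerivAt_rpow_const (x := u) (p := γ) (Or.inr hγ)).div_const (2 * γ)
  have h2 : γ * u ^ (γ - 1) / (2 * γ) = u ^ (γ - 1) / 2 := by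
    have : γ ≠ 0 := by linarith
    field_simp
  rw [h2] at h
  exact h

lemma deriv_fGamma {γ : ℝ} (hγ : 1 ≤ γ) (u : ℝ) : deriv (fGamma γ) u = u ^ (γ - 1) / 2 :=
  (hasDerivAt_fGamma hγ u).deriv

section

variable {ν : Measure ℝ}

lemma integral_tiltedVar_anti (hν : ∀ᵐ x ∂ν, 0 ≤ x) (hi : Integrable (fun x : ℝ => x) ν)
    {s t : ℝ} (hs : 0 ≤ s) (hst : s ≤ t) :
    ∫ x, tiltedVar t x ∂ν ≤ ∫ x, tiltedVar s x ∂ν := by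
  refine integral_mono_ae (integrable_tiltedVar hν hi (hs.trans hst))
    (integrable_tiltedVar hν hi hs) ?_
  filter_upwards [hν] with x hx
  have : 0 ≤ s * x := by positivity
  unfold tiltedVar
  gcongr

lemma integral_tiltedVar_nonneg (hν : ∀ᵐ x ∂ν, 0 ≤ x) {t : ℝ} (ht : 0 ≤ t) :
    0 ≤ ∫ x, tiltedVar t x ∂ν :=
  integral_nonneg_of_ae (hν.mono fun _ hx => tiltedVar_nonneg ht hx)

lemma continuousOn_integral_tiltedVar (hν : ∀ᵐ x ∂ν, 0 ≤ x)
    (hi : Integrable (fun x : ℝ => x) ν) :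
    ContinuousOn (fun t => ∫ x, tiltedVar t x ∂ν) (Ici 0) := by
  refine continuousOn_of_dominated (bound := fun x => 2 * x) (fun t ht => ?_) (fun t ht => ?_)
    (hi.const_mul 2) ?_
  · exact (integrable_tiltedVar hν hi ht).aestronglyMeasurable
  · filter_upwards [hν] with x hx
    have ht' : 0 ≤ t := ht
    have : 0 ≤ t * x := by positivity
    rw [Real.norm_of_nonneg (tiltedVar_nonneg ht' hx)]
    have h1 : x / (1 + t * x) ≤ x := div_le_self hx (by linarith)
    have h2 : x / (1 + t * x) ^ 2 ≤ x := div_le_self hx (one_le_pow₀ (by linarith))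
    unfold tiltedVar
    linarith
  · filter_upwards [hν] with x hx t ht
    have ht' : 0 ≤ t := ht
    have : 0 ≤ t * x := by positivity
    have h2 : 1 + t * x ≠ 0 := by positivity
    have h3 : ContinuousAt (fun t : ℝ => x / (1 + t * x) + x / (1 + t * x) ^ 2) t := by
      fun_prop (disch := simp [h2])
    exact h3.continuousWithinAt

lemma saddleEquations_iff {γ : ℝ} (hγ : 1 ≤ γ) (h m l t : ℝ) :
    SaddleEquations ν γ h m l t ↔
      t = m / h ^ 2 * (l / h ^ 2) ^ (γ - 1) ∧ l = ∫ x, tiltedVar t x ∂ν := by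
  unfold SaddleEquations
  rw [deriv_fGamma hγ]
  refine and_congr ⟨fun H => by linarith, fun H => by linarith⟩ Iff.rfl

/-- Eliminating `t` leaves the fixed-point equation `l = Lf (T l)`, whose right side is continuous
and nonincreasing. It is nonnegative at `0` and at most `Lf 0` at `Lf 0`, so the intermediate value
theorem gives a solution, and monotonicity makes it unique. -/
lemma existsUnique_saddleEquations (hν : ∀ᵐ x ∂ν, 0 ≤ x)
    (hi : Integrable (fun x : ℝ => x) ν) {γ h m : ℝ} (hγ : 1 ≤ γ) (hm : 0 < m) :
    ∃! p : ℝ × ℝ, 0 ≤ p.1 ∧ 0 ≤ p.2 ∧ SaddleEquations ν γ h m p.1 p.2 := by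
  set T : ℝ → ℝ := fun l => m / h ^ 2 * (l / h ^ 2) ^ (γ - 1) with hT
  have hT0 : ∀ l, 0 ≤ l → 0 ≤ T l := fun l hl => by
    rw [hT]
    have := Real.rpow_nonneg (show 0 ≤ l / h ^ 2 by positivity) (γ - 1)
    positivity
  have hTmono : ∀ l l', 0 ≤ l → l ≤ l' → T l ≤ T l' := fun l l' hl hll => by
    have := Real.rpow_le_rpow (show 0 ≤ l / h ^ 2 by positivity)
      (show l / h ^ 2 ≤ l' / h ^ 2 by gcongr) (by linarith : 0 ≤ γ - 1)
    simp only [hT]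
    gcongr
  have hTcont : Continuous T := by
    refine continuous_const.mul (Continuous.rpow_const (by fun_prop) fun _ => Or.inr (by linarith))
  set Lf : ℝ → ℝ := fun t => ∫ x, tiltedVar t x ∂ν with hLf
  have hL0 : ∀ t, 0 ≤ t → 0 ≤ Lf t := fun t ht => integral_tiltedVar_nonneg hν ht
  have hcont : ContinuousOn (fun l => l - Lf (T l)) (Icc 0 (Lf 0)) := by
    refine continuousOn_id.sub ((continuousOn_integral_tiltedVar hν hi).comp
      hTcont.continuousOn fun l hl => hT0 l hl.1)
  have hIVT := intermediate_value_Icc (hL0 0 le_rfl) hcont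
  obtain ⟨l, hl, hl0⟩ := hIVT (show (0 : ℝ) ∈ _ by
    refine ⟨?_, ?_⟩
    · have := hL0 _ (hT0 0 le_rfl)
      linarith
    · have := integral_tiltedVar_anti hν hi le_rfl (hT0 _ (hL0 0 le_rfl))
      linarith)
  have hl1 : l = Lf (T l) := by simp only at hl0; linarith
  refine ⟨(l, T l), ⟨hl.1, hT0 l hl.1, (saddleEquations_iff hγ _ _ _ _).2 ⟨rfl, hl1⟩⟩, ?_⟩
  rintro ⟨l', t'⟩ ⟨hl', ht', hS⟩
  obtain ⟨h1, h2⟩ := (saddleEquations_iff hγ _ _ _ _).1 hS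
  simp only at hl' ht' h1 h2
  have h3 : l' = Lf (T l') := by
    rw [h1] at h2
    exact h2
  have h4 : l' = l := by
    rcases le_total l l' with hle | hle
    · have : Lf (T l') ≤ Lf (T l) :=
        integral_tiltedVar_anti hν hi (hT0 l hl.1) (hTmono l l' hl.1 hle)
      linarith
    · have : Lf (T l) ≤ Lf (T l') :=
        integral_tiltedVar_anti hν hi (hT0 l' hl') (hTmono l' l hl' hle)
      linarith
  rw [Prod.mk.injEq]
  refine ⟨h4, ?_⟩
  rw [h1, h4]

lemma hasDerivWithinAt_integral_log_one_add (hν : ∀ᵐ x ∂ν, 0 ≤ x)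
    (hi : Integrable (fun x : ℝ => x) ν) {t : ℝ} (ht : 0 ≤ t) :
    HasDerivWithinAt (fun t => ∫ x, Real.log (1 + t * x) ∂ν) (∫ x, x / (1 + t * x) ∂ν)
      (Ici 0) t := by
  refine hasDerivWithinAt_integral_of_lipschitz ht
    (fun s hs => integrable_log_one_add hν hi hs) hi ?_ ?_
  · filter_upwards [hν] with x hx s hs
    -- The bound `log r ≤ r - 1` gives a one-sided Lipschitz estimate with constant `x`; exchanging
    -- the arguments gives the other side.
    have key : ∀ u v : ℝ, 0 ≤ u → 0 ≤ v →
        Real.log (1 + u * x) - Real.log (1 + v * x) ≤ x * |u - v| := by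
      intro u v hu hv
      have hux : 0 ≤ u * x := by positivity
      have hvx : 0 ≤ v * x := by positivity
      rw [← Real.log_div (by positivity) (by positivity)]
      refine (Real.log_le_sub_one_of_pos (by positivity)).trans ?_
      have h1 : (1 + u * x) / (1 + v * x) - 1 = x * (u - v) / (1 + v * x) := by
        field_simp
        ring
      rw [h1]
      have h2 : x * (u - v) ≤ x * |u - v| := mul_le_mul_of_nonneg_left (le_abs_self _) hx
      have h3 : 0 ≤ x * |u - v| := by positivity
      rw [div_le_iff₀ (by positivity)]
      nlinarith
    rw [abs_le]
    have h1 := key s t hs ht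
    have h2 := key t s ht hs
    rw [abs_sub_comm] at h2
    constructor <;> linarith
  · filter_upwards [hν] with x hx
    have : 0 ≤ t * x := by positivity
    have h1 : HasDerivAt (fun t => 1 + t * x) x t := by
      simpa using ((hasDerivAt_id t).mul_const x).const_add 1
    exact (h1.log (by positivity)).hasDerivWithinAt

lemma hasDerivWithinAt_integral_mul_div_one_add (hν : ∀ᵐ x ∂ν, 0 ≤ x)
    (hi : Integrable (fun x : ℝ => x) ν) {t : ℝ} (ht : 0 ≤ t) :
    HasDerivWithinAt (fun t => ∫ x, t * x / (1 + t * x) ∂ν) (∫ x, x / (1 + t * x) ^ 2 ∂ν)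
      (Ici 0) t := by
  refine hasDerivWithinAt_integral_of_lipschitz ht
    (fun s hs => integrable_mul_div_one_add hν hi hs) hi ?_ ?_
  · filter_upwards [hν] with x hx s hs
    have hs' : 0 ≤ s := hs
    have hsx : 0 ≤ s * x := by positivity
    have htx : 0 ≤ t * x := by positivity
    have h1 : s * x / (1 + s * x) - t * x / (1 + t * x) =
        x * (s - t) / ((1 + s * x) * (1 + t * x)) := by
      field_simp
      ring
    rw [h1, abs_div, abs_mul, abs_of_nonneg hx,
      abs_of_pos (by positivity : 0 < (1 + s * x) * (1 + t * x))]
    refine div_le_self (by positivity) ?_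
    nlinarith [mul_nonneg hsx htx]
  · filter_upwards [hν] with x hx
    have : 0 ≤ t * x := by positivity
    have h0 : HasDerivAt (fun t => t * x) x t := by
      simpa using (hasDerivAt_id t).mul_const x
    have h1 := h0.div (h0.const_add 1) (by positivity : 1 + t * x ≠ 0)
    convert! h1.hasDerivWithinAt using 1
    congr 1
    ring

/-- The `l`-derivative is a nonzero multiple of the defect in the first equation, the `t`-derivative
of that in the second. One-sided derivatives are unique on `Ici 0`, so vanishing can be read off,
including at the boundary. -/
lemma saddleEquations_iff_isStationaryPhiGauss (hν : ∀ᵐ x ∂ν, 0 ≤ x)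
    (hi : Integrable (fun x : ℝ => x) ν) {γ α h m l t : ℝ} (hγ : 1 ≤ γ) (hh : 0 < h) (hm : 0 < m)
    (hl : 0 ≤ l) (ht : 0 ≤ t) :
    SaddleEquations ν γ h m l t ↔ IsStationaryPhiGauss ν γ α h m l t := by
  have hU : ∀ x : ℝ, 0 ≤ x → UniqueDiffWithinAt ℝ (Ici (0 : ℝ)) x := fun x hx =>
    uniqueDiffOn_Ici 0 x hx
  have hd1 : HasDerivWithinAt (fun l' => phiGauss ν γ α h m l' t)
      (-(deriv (fGamma γ) (l / h ^ 2) * (1 / h ^ 2)) + t / (2 * m)) (Ici 0) l := by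
    have h1 : HasDerivAt (fun l' : ℝ => l' / h ^ 2) (1 / h ^ 2) l :=
      (hasDerivAt_id l).div_const _
    have h2 : HasDerivAt (fun l' => fGamma γ (l' / h ^ 2))
        (deriv (fGamma γ) (l / h ^ 2) * (1 / h ^ 2)) l := by
      rw [deriv_fGamma hγ]
      exact (hasDerivAt_fGamma hγ (l / h ^ 2)).comp l h1
    have h3 : HasDerivAt (fun l' : ℝ => t * l' / (2 * m)) (t / (2 * m)) l := by
      simpa using ((hasDerivAt_id l).const_mul t).div_const (2 * m)
    unfold phiGauss
    have h4 := ((((h2.const_sub ((1 - m) / m * α + cGamma γ)).sub_const (Real.log h)).sub_const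
      (1 / (2 * m) * (∫ c, Real.log (1 + t * c) ∂ν))).sub_const
      (1 / (2 * m) * (∫ c, t * c / (1 + t * c) ∂ν))).add h3
    exact h4.hasDerivWithinAt
  have hd2 : HasDerivWithinAt (fun t' => phiGauss ν γ α h m l t')
      (1 / (2 * m) * (l - ∫ x, tiltedVar t x ∂ν)) (Ici 0) t := by
    have h1 := (hasDerivWithinAt_integral_log_one_add hν hi ht).const_mul (1 / (2 * m))
    have h2 := (hasDerivWithinAt_integral_mul_div_one_add hν hi ht).const_mul (1 / (2 * m))
    have h3 : HasDerivWithinAt (fun t' : ℝ => t' * l / (2 * m)) (l / (2 * m)) (Ici 0) t := by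
      simpa using (((hasDerivAt_id t).mul_const l).div_const (2 * m)).hasDerivWithinAt
    have h4 := ((h1.const_sub ((1 - m) / m * α + cGamma γ - fGamma γ (l / h ^ 2) -
      Real.log h)).sub h2).add h3
    have hI1 : Integrable (fun x => x / (1 + t * x)) ν := by
      simpa using integrable_div_one_add_pow hν hi ht 1
    have h5 : ∫ x, tiltedVar t x ∂ν =
        ∫ x, x / (1 + t * x) ∂ν + ∫ x, x / (1 + t * x) ^ 2 ∂ν :=
      integral_add hI1 (integrable_div_one_add_pow hν hi ht 2)
    unfold phiGauss
    rw [h5]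
    convert! h4 using 1
    ring
  have hiff1 : HasDerivWithinAt (fun l' => phiGauss ν γ α h m l' t) 0 (Ici 0) l ↔
      -(deriv (fGamma γ) (l / h ^ 2) * (1 / h ^ 2)) + t / (2 * m) = 0 :=
    ⟨fun H => (hU l hl).eq_deriv _ hd1 H, fun H => H ▸ hd1⟩
  have hiff2 : HasDerivWithinAt (fun t' => phiGauss ν γ α h m l t') 0 (Ici 0) t ↔
      1 / (2 * m) * (l - ∫ x, tiltedVar t x ∂ν) = 0 :=
    ⟨fun H => (hU t ht).eq_deriv _ hd2 H, fun H => H ▸ hd2⟩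
  unfold SaddleEquations IsStationaryPhiGauss
  rw [hiff1, hiff2]
  refine and_congr ?_ ?_
  · have h1 : t / 2 - m / h ^ 2 * deriv (fGamma γ) (l / h ^ 2) =
        m * (-(deriv (fGamma γ) (l / h ^ 2) * (1 / h ^ 2)) + t / (2 * m)) := by
      field_simp
      ring
    rw [← sub_eq_zero, h1, mul_eq_zero]
    simp [hm.ne']
  · rw [mul_eq_zero, sub_eq_zero]
    have : 1 / (2 * m) ≠ 0 := by positivity
    simp only [this, false_or]
    rfl

end

/-! ### Passage to eigenvector coordinates -/

section Transfer

variable {ι : Type*} [Fintype ι] [DecidableEq ι] {S : Matrix ι ι ℝ}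

/-- The linear map sending a standard Gaussian vector to a Gaussian vector with covariance `S`. -/
noncomputable def eigenMap (hS : S.IsHermitian) : (ι → ℝ) →ₗ[ℝ] EuclideanSpace ℝ ι where
  toFun z := ∑ i, (√(hS.eigenvalues i) * z i) • hS.eigenvectorBasis i
  map_add' z y := by
    simp [mul_add, add_smul, Finset.sum_add_distrib]
  map_smul' a z := by
    simp only [Pi.smul_apply, smul_eq_mul, RingHom.id_apply, Finset.smul_sum, smul_smul]
    refine Finset.sum_congr rfl fun i _ => ?_
    ring_nf

lemma eigenMap_apply (hS : S.IsHermitian) (z : ι → ℝ) :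
    eigenMap hS z = ∑ i, (√(hS.eigenvalues i) * z i) • hS.eigenvectorBasis i := rfl

@[fun_prop]
lemma measurable_eigenMap (hS : S.IsHermitian) : Measurable (eigenMap hS) :=
  (LinearMap.continuous_of_finiteDimensional _).measurable

lemma multivariateGaussian_eq_map_eigenMap (hS : S.PosSemidef) :
    multivariateGaussian 0 S = (gaussianPi ι).map (eigenMap hS.isHermitian) :=
  multivariateGaussian_eq_map_gaussianPi hS

lemma norm_eigenMap_sq (hS : S.PosSemidef) (z : ι → ℝ) :
    ‖eigenMap hS.isHermitian z‖ ^ 2 = ∑ i, hS.isHermitian.eigenvalues i * z i ^ 2 := by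
  rw [← hS.isHermitian.eigenvectorBasis.sum_sq_norm_inner_right]
  refine Finset.sum_congr rfl fun i _ => ?_
  rw [eigenMap_apply, hS.isHermitian.eigenvectorBasis.orthonormal.inner_right_fintype, Real.norm_eq_abs, sq_abs, mul_pow,
    Real.sq_sqrt (hS.eigenvalues_nonneg i)]

lemma norm_eigenMap_sub_sq (hS : S.PosSemidef) (z y : ι → ℝ) :
    ‖eigenMap hS.isHermitian z - eigenMap hS.isHermitian y‖ ^ 2 =
      weightedSqDist hS.isHermitian.eigenvalues z y := by
  rw [← map_sub, norm_eigenMap_sq hS]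
  rfl

lemma integral_multivariateGaussian (hS : S.PosSemidef) {φ : EuclideanSpace ℝ ι → ℝ}
    (hφ : Measurable φ) :
    ∫ x, φ x ∂(multivariateGaussian 0 S) =
      ∫ z, φ (eigenMap hS.isHermitian z) ∂(gaussianPi ι) := by
  rw [multivariateGaussian_eq_map_eigenMap hS,
    integral_map (measurable_eigenMap _).aemeasurable hφ.aestronglyMeasurable]

lemma integrable_multivariateGaussian_iff (hS : S.PosSemidef) {φ : EuclideanSpace ℝ ι → ℝ}
    (hφ : Measurable φ) :
    Integrable φ (multivariateGaussian 0 S) ↔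
      Integrable (fun z => φ (eigenMap hS.isHermitian z)) (gaussianPi ι) := by
  rw [multivariateGaussian_eq_map_eigenMap hS,
    integrable_map_measure hφ.aestronglyMeasurable (measurable_eigenMap _).aemeasurable]
  rfl

lemma multivariateGaussian_absolutelyContinuous (hS : S.PosDef) :
    multivariateGaussian 0 S ≪ (volume : Measure (EuclideanSpace ℝ ι)) := by
  rw [multivariateGaussian_eq_map_eigenMap hS.posSemidef]
  have h1 : gaussianPi ι ≪ volume := by
    rw [← volume_tilted_eq_gaussianPi]
    exact tilted_absolutelyContinuous _ _
  have hsurj : Function.Surjective (eigenMap hS.posSemidef.isHermitian) := by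
    intro y
    set b := hS.posSemidef.isHermitian.eigenvectorBasis
    refine ⟨fun i => (√(hS.posSemidef.isHermitian.eigenvalues i))⁻¹ * inner ℝ (b i) y, ?_⟩
    rw [eigenMap_apply]
    conv_rhs => rw [← b.sum_repr' y]
    refine Finset.sum_congr rfl fun i _ => ?_
    have : √(hS.posSemidef.isHermitian.eigenvalues i) ≠ 0 :=
      (Real.sqrt_pos.2 (hS.eigenvalues_pos i)).ne'
    rw [mul_inv_cancel_left₀ this]
  -- A surjective linear map sends Lebesgue measure to a multiple of Lebesgue measure, possibly with
  -- infinite factor; absolute continuity survives in any case.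
  obtain ⟨a, -, ha⟩ := (eigenMap hS.posSemidef.isHermitian).exists_map_addHaar_eq_smul_addHaar
    (volume : Measure (ι → ℝ)) (volume : Measure (EuclideanSpace ℝ ι)) hsurj
  refine (h1.map (measurable_eigenMap _)).trans ?_
  rw [ha]
  exact Measure.smul_absolutelyContinuous

end Transfer

/-! ### Purity of Gaussian densities -/

section CumulantGen

variable {d : ℕ} {S : Matrix (Fin d) (Fin d) ℝ}

lemma measurable_cumulantGen (ρ : Measure (EuclideanSpace ℝ (Fin d))) [SFinite ρ] (h lam : ℝ) :
    Measurable (cumulantGen d ρ h lam) := by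
  unfold cumulantGen
  refine (Real.measurable_log.comp ?_).const_mul _
  have : StronglyMeasurable
      (fun p : EuclideanSpace ℝ (Fin d) × EuclideanSpace ℝ (Fin d) =>
        Real.exp (-((d : ℝ) * lam * (‖p.1 - p.2‖ ^ 2 / ((d : ℝ) * h ^ 2))))) :=
    Measurable.stronglyMeasurable (by fun_prop)
  exact this.integral_prod_right.measurable

lemma cumulantGen_eigenMap (hS : S.PosSemidef) {h lam : ℝ} (hlam : 0 ≤ lam)
    (z : Fin d → ℝ) :
    cumulantGen d (multivariateGaussian 0 S) h lam (eigenMap hS.isHermitian z) =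
      1 / (d : ℝ) * (-(1 / 2) * (∑ i, Real.log
        (1 + 2 * lam / h ^ 2 * hS.isHermitian.eigenvalues i)) -
        ∑ i, 2 * lam / h ^ 2 * hS.isHermitian.eigenvalues i /
          (2 * (1 + 2 * lam / h ^ 2 * hS.isHermitian.eigenvalues i)) * z i ^ 2) := by
  rcases Nat.eq_zero_or_pos d with rfl | hd
  · simp [cumulantGen]
  have hd' : (d : ℝ) ≠ 0 := by exact_mod_cast hd.ne'
  rw [← log_integral_exp_neg_weightedSqDist hS.eigenvalues_nonneg (by positivity), cumulantGen,
    integral_multivariateGaussian hS (by fun_prop)]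
  congr 3
  ext y
  rw [norm_eigenMap_sub_sq hS]
  congr 2
  field_simp

lemma memLp_cumulantGen_eigenMap (hS : S.PosSemidef) {h lam : ℝ} (hlam : 0 ≤ lam) :
    MemLp (fun z => cumulantGen d (multivariateGaussian 0 S) h lam (eigenMap hS.isHermitian z)) 2
      (gaussianPi (Fin d)) := by
  simp_rw [cumulantGen_eigenMap hS hlam]
  exact ((memLp_const _).sub (memLp_sum_mul_sq_gaussianPi _ 2)).const_mul _

/-- The weights have the form `κ / (2 * (1 + κ)) ≤ 1 / 2`, so no bound on the eigenvalues is needed;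
independence and the prefactor `1 / d` give a variance of order `1 / d`, ready for Chebyshev. -/
lemma variance_cumulantGen_eigenMap_le (hS : S.PosSemidef) {h lam : ℝ} (hlam : 0 ≤ lam) :
    Var[fun z => cumulantGen d (multivariateGaussian 0 S) h lam (eigenMap hS.isHermitian z);
      gaussianPi (Fin d)] ≤
      1 / (d : ℝ) * ((1 / 2) ^ 2 * Var[fun x => x ^ 2; gaussianReal 0 1]) := by
  simp_rw [cumulantGen_eigenMap hS hlam]
  rw [variance_const_mul, variance_const_sub (memLp_sum_mul_sq_gaussianPi _ 2).1]
  rcases Nat.eq_zero_or_pos d with rfl | hd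
  · simp
  have hd' : (0 : ℝ) < d := by exact_mod_cast hd
  have h1 := variance_sum_mul_sq_gaussianPi_le (B := 1 / 2) (β := fun i =>
    2 * lam / h ^ 2 * hS.isHermitian.eigenvalues i /
      (2 * (1 + 2 * lam / h ^ 2 * hS.isHermitian.eigenvalues i))) (fun i => by
    have h2 : 0 ≤ 2 * lam / h ^ 2 * hS.isHermitian.eigenvalues i :=
      mul_nonneg (by positivity) (hS.eigenvalues_nonneg i)
    rw [abs_of_nonneg (by positivity), div_le_div_iff₀ (by positivity) (by positivity)]
    linarith)
  rw [Fintype.card_fin] at h1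
  calc _ ≤ (1 / (d : ℝ)) ^ 2 * (d * ((1 / 2) ^ 2 * Var[fun x => x ^ 2; gaussianReal 0 1])) := by
        gcongr
    _ = _ := by field_simp

/-- Gaussian densities are pure. -/
lemma isPureDensity_multivariateGaussian (C : ∀ d : ℕ, Matrix (Fin d) (Fin d) ℝ)
    (hC : ∀ d, (C d).PosDef) : IsPureDensity fun d => multivariateGaussian 0 (C d) := by
  refine ⟨fun d => inferInstance, fun d => multivariateGaussian_absolutelyContinuous (hC d),
    fun h lam hh hlam => ⟨fun d => ?_, fun ε hε => ?_⟩⟩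
  · rw [integrable_multivariateGaussian_iff (hC d).posSemidef (measurable_cumulantGen _ _ _)]
    exact (memLp_cumulantGen_eigenMap (hC d).posSemidef hlam).integrable one_le_two
  · set V := Var[fun x => x ^ 2; gaussianReal 0 1]
    have hlim : Tendsto (fun d : ℕ => ENNReal.ofReal (1 / (d : ℝ) * ((1 / 2) ^ 2 * V) / ε ^ 2))
        atTop (𝓝 0) := by
      have h1 := ((tendsto_one_div_atTop_nhds_zero_nat (𝕜 := ℝ)).mul_const
        ((1 / 2) ^ 2 * V)).div_const (ε ^ 2)
      rw [zero_mul, zero_div] at h1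
      simpa using ENNReal.tendsto_ofReal h1
    refine tendsto_of_tendsto_of_tendsto_of_le_of_le tendsto_const_nhds hlim
      (fun d => bot_le) (fun d => ?_)
    have hS := (hC d).posSemidef
    have hm := measurable_cumulantGen (multivariateGaussian 0 (C d)) h lam
    simp only
    rw [integral_multivariateGaussian hS hm]
    nth_rw 1 [multivariateGaussian_eq_map_eigenMap hS]
    rw [Measure.map_apply (measurable_eigenMap _)
      (measurableSet_le measurable_const (hm.sub_const _).abs)]
    refine (meas_ge_le_variance_div_sq (memLp_cumulantGen_eigenMap hS hlam) hε).trans ?_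
    refine ENNReal.ofReal_le_ofReal ?_
    gcongr
    exact variance_cumulantGen_eigenMap_le hS hlam

end CumulantGen

/-! ### Scaling in `d` and the normalization constant -/

lemma const_mul_rpow_mean {d : ℕ} {γ B s : ℝ} (hs : 0 ≤ s) :
    (d : ℝ) * B * (1 / (d : ℝ)) ^ γ * s ^ γ = (d : ℝ) * (B * (1 / (d : ℝ) * s) ^ γ) := by
  rw [Real.mul_rpow (by positivity) hs]
  ring

/-- A tangent point `d * l` for the unscaled sum corresponds to `l` for the average: the powers of
`d` cancel, so the slope condition does not depend on the dimension. -/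
lemma slope_const_mul_rpow {d : ℕ} (hd : 0 < d) {γ B l : ℝ} (hl : 0 ≤ l) :
    (d : ℝ) * B * (1 / (d : ℝ)) ^ γ * (γ * (d * l) ^ (γ - 1)) = B * (γ * l ^ (γ - 1)) := by
  have hd' : (0 : ℝ) < d := by exact_mod_cast hd
  rw [Real.mul_rpow hd'.le hl, Real.rpow_sub_one hd'.ne', one_div, Real.inv_rpow hd'.le]
  have : (d : ℝ) ^ γ ≠ 0 := (Real.rpow_pos_of_pos hd' γ).ne'
  field_simp

lemma tendsto_const_div_sqrt_nat (K : ℝ) :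
    Tendsto (fun d : ℕ => K / √(d : ℝ)) atTop (𝓝 0) :=
  Tendsto.const_div_atTop (Real.tendsto_sqrt_atTop.comp tendsto_natCast_atTop_atTop) K

lemma gammaNormalization_eq (d : ℕ) (γ : ℝ) :
    gammaNormalization d γ = -((1 / (d : ℝ)) * Real.log (∫ x : Fin d → ℝ,
      Real.exp (-((d : ℝ) * (1 / (2 * γ)) * (1 / (d : ℝ)) ^ γ * (∑ i, x i ^ 2) ^ γ)))) := by
  unfold gammaNormalization
  rw [← (PiLp.volume_preserving_toLp (Fin d)).integral_comp
    (MeasurableEquiv.toLp 2 _).measurableEmbedding]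
  congr 4
  ext x
  have hx : 0 ≤ ∑ i, x i ^ 2 := Finset.sum_nonneg fun i _ => sq_nonneg _
  rw [const_mul_rpow_mean hx, EuclideanSpace.real_norm_sq_eq]
  congr 5
  simp only
  ring

/-- The normalization constants of the `γ`-kernels converge. -/
lemma tendsto_gammaNormalization {γ : ℝ} (hγ : 1 ≤ γ) :
    Tendsto (fun d => gammaNormalization d γ) atTop (𝓝 (cGamma γ)) := by
  have hγ0 : 0 < γ := by linarith
  obtain ⟨K, hK⟩ := exists_integral_rpow_mean_le hγ 1
  have hup : Tendsto (fun d : ℕ => cGamma γ + 1 / (2 * γ) * (K / √(d : ℝ))) atTop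
      (𝓝 (cGamma γ)) := by
    simpa using ((tendsto_const_div_sqrt_nat K).const_mul (1 / (2 * γ))).const_add (cGamma γ)
  refine tendsto_of_tendsto_of_tendsto_of_le_of_le' tendsto_const_nhds hup ?_ ?_
  all_goals
    filter_upwards [eventually_gt_atTop 0] with d hd
    have hd' : (0 : ℝ) < d := by exact_mod_cast hd
    have ha : 0 ≤ (d : ℝ) * (1 / (2 * γ)) * (1 / (d : ℝ)) ^ γ := by positivity
    -- The tangent point is `q = d`, the mean of `|x| ^ 2` under the standard Gaussian trial
    -- measure; this makes the two bounds agree to leading order.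
    have haq : 1 / 2 = (d : ℝ) * (1 / (2 * γ)) * (1 / (d : ℝ)) ^ γ * (γ * (d : ℝ) ^ (γ - 1)) := by
      have := slope_const_mul_rpow hd (γ := γ) (B := 1 / (2 * γ)) zero_le_one
      rw [mul_one] at this
      rw [this, Real.one_rpow]
      field_simp
    rw [gammaNormalization_eq]
  · have h := log_integral_volume_exp_neg_rpow_le (ι := Fin d) ha hγ hd'.le haq
    rw [const_mul_rpow_mean hd'.le, Fintype.card_fin, one_div_mul_cancel hd'.ne',
      Real.one_rpow] at h
    have h2 := mul_le_mul_of_nonneg_left h (by positivity : 0 ≤ 1 / (d : ℝ))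
    have h3 : 1 / (d : ℝ) * (-(d * (1 / (2 * γ) * 1)) + 1 / 2 * d +
        d * (1 / 2 * Real.log (2 * Real.pi))) = -cGamma γ := by
      unfold cGamma
      field_simp
      ring
    linarith
  · have h := le_log_integral_volume_exp_neg_rpow (ι := Fin d) ha hγ hd'.le haq
    have h1 : ∀ w : Fin d → ℝ, (d : ℝ) * (1 / (2 * γ)) * (1 / (d : ℝ)) ^ γ *
        (∑ i, w i ^ 2) ^ γ = d * (1 / (2 * γ) * (1 / (d : ℝ) * ∑ i, w i ^ 2) ^ γ) := fun w =>
      const_mul_rpow_mean (Finset.sum_nonneg fun i _ => sq_nonneg _)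
    rw [← integral_const_mul] at h
    simp_rw [h1] at h
    rw [integral_const_mul, integral_const_mul, Fintype.card_fin] at h
    have h4 := hK d hd (fun _ => 1) (fun _ => zero_le_one) (fun _ => le_rfl)
    simp only [one_mul, Finset.sum_const, Finset.card_univ, Fintype.card_fin, nsmul_eq_mul,
      mul_one, one_div_mul_cancel hd'.ne', Real.one_rpow] at h4
    set I := ∫ w : Fin d → ℝ, (1 / (d : ℝ) * ∑ i, w i ^ 2) ^ γ ∂(gaussianPi (Fin d))
    have h2 := mul_le_mul_of_nonneg_left h (by positivity : 0 ≤ 1 / (d : ℝ))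
    have h3 : 1 / (d : ℝ) * (d * (1 / 2 * Real.log (2 * Real.pi)) + 1 / 2 * d -
        d * (1 / (2 * γ) * I)) = -cGamma γ + 1 / (2 * γ) - 1 / (2 * γ) * I := by
      unfold cGamma
      field_simp
      ring
    have h5 : 1 / (2 * γ) * I ≤ 1 / (2 * γ) * (1 + K / √(d : ℝ)) := by gcongr
    simp_rw [h1]
    linarith

/-! ### Kernel moments in eigenvector coordinates -/

section

variable {d : ℕ} {S : Matrix (Fin d) (Fin d) ℝ}

lemma logKernelMoment_eigenMap (hS : S.PosSemidef) {γ h m : ℝ} (hγ : 1 ≤ γ) (hm : 0 < m)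
    (z : Fin d → ℝ) :
    logKernelMoment d (multivariateGaussian 0 S) (gammaKernel γ d) h m
      (eigenMap hS.isHermitian z) =
      d * m * gammaNormalization d γ +
        logPowerMoment hS.isHermitian.eigenvalues
          (d * (m / (2 * γ) * (1 / h ^ 2) ^ γ) * (1 / (d : ℝ)) ^ γ) γ z := by
  have hmeas : Measurable fun y : EuclideanSpace ℝ (Fin d) =>
      (gammaKernel γ d (h⁻¹ • (eigenMap hS.isHermitian z - y))) ^ m := by
    unfold gammaKernel
    fun_prop
  have hpt : ∀ y, (gammaKernel γ d (h⁻¹ • (eigenMap hS.isHermitian z -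
      eigenMap hS.isHermitian y))) ^ m =
      Real.exp (d * m * gammaNormalization d γ) *
        Real.exp (-((d * (m / (2 * γ) * (1 / h ^ 2) ^ γ) * (1 / (d : ℝ)) ^ γ) *
          weightedSqDist hS.isHermitian.eigenvalues z y ^ γ)) := by
    intro y
    have hW := weightedSqDist_nonneg hS.eigenvalues_nonneg z y
    rw [gammaKernel, ← Real.exp_mul, ← Real.exp_add, norm_smul, mul_pow, norm_eigenMap_sub_sq hS]
    congr 1
    have h1 : (‖h⁻¹‖ ^ 2 * weightedSqDist hS.isHermitian.eigenvalues z y / (d : ℝ)) =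
        1 / h ^ 2 * (1 / (d : ℝ)) * weightedSqDist hS.isHermitian.eigenvalues z y := by
      rw [Real.norm_eq_abs, sq_abs]
      ring
    rw [h1, Real.mul_rpow (by positivity) hW, Real.mul_rpow (by positivity) (by positivity)]
    ring
  rw [logKernelMoment, integral_multivariateGaussian hS hmeas]
  simp_rw [hpt]
  rw [integral_const_mul, logPowerMoment]
  rw [Real.log_mul (Real.exp_pos _).ne' (integral_exp_pos
    (integrable_exp_neg_rpow_weightedSqDist hS.eigenvalues_nonneg (by positivity) γ z)).ne',
    Real.log_exp]

lemma measurable_logKernelMoment (ρ : Measure (EuclideanSpace ℝ (Fin d))) [SFinite ρ]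
    (γ h m : ℝ) : Measurable (logKernelMoment d ρ (gammaKernel γ d) h m) := by
  unfold logKernelMoment
  refine Real.measurable_log.comp ?_
  have : StronglyMeasurable
      (fun p : EuclideanSpace ℝ (Fin d) × EuclideanSpace ℝ (Fin d) =>
        (gammaKernel γ d (h⁻¹ • (p.1 - p.2))) ^ m) := by
    refine Measurable.stronglyMeasurable ?_
    unfold gammaKernel
    fun_prop
  exact this.integral_prod_right.measurable

lemma integrable_logKernelMoment (hS : S.PosSemidef) {γ h m : ℝ} (hγ : 1 ≤ γ) (hm : 0 < m) :
    Integrable (logKernelMoment d (multivariateGaussian 0 S) (gammaKernel γ d) h m)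
      (multivariateGaussian 0 S) := by
  rw [integrable_multivariateGaussian_iff hS (measurable_logKernelMoment _ _ _ _)]
  simp_rw [logKernelMoment_eigenMap hS hγ hm]
  exact (integrable_const _).add (integrable_logPowerMoment hS.eigenvalues_nonneg
    (by positivity) (by linarith))

lemma integral_logKernelMoment (hS : S.PosSemidef) {γ h m : ℝ} (hγ : 1 ≤ γ) (hm : 0 < m) :
    ∫ x, logKernelMoment d (multivariateGaussian 0 S) (gammaKernel γ d) h m x
      ∂(multivariateGaussian 0 S) =
      d * m * gammaNormalization d γ + ∫ z, logPowerMoment hS.isHermitian.eigenvalues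
          (d * (m / (2 * γ) * (1 / h ^ 2) ^ γ) * (1 / (d : ℝ)) ^ γ) γ z
          ∂(gaussianPi (Fin d)) := by
  rw [integral_multivariateGaussian hS (measurable_logKernelMoment _ _ _ _)]
  simp_rw [logKernelMoment_eigenMap hS hγ hm]
  rw [integral_add (integrable_const _) (integrable_logPowerMoment hS.eigenvalues_nonneg
    (by positivity) (by linarith))]
  simp

end

/-! ### Limit of the averaged log-partition function -/

namespace IsSpectralArray

variable {c : ∀ d : ℕ, Fin d → ℝ} {ν : Measure ℝ} [IsProbabilityMeasure ν]

/-- Asymptotic lower bound for the average log-partition function. -/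
lemma exists_tendsto_le_integral_logPowerMoment (hc : IsSpectralArray c ν) {γ B t : ℝ}
    (hγ : 1 ≤ γ) (hB : 0 ≤ B) (ht : 0 < t) :
    ∃ u : ℕ → ℝ, Tendsto u atTop (𝓝 (-(1 / 2) * (∫ x, Real.log (1 + t * x) ∂ν) -
      1 / 2 * (∫ x, t * x / (1 + t * x) ∂ν) + (t / 2 * (∫ x, tiltedVar t x ∂ν) -
        B * (∫ x, tiltedVar t x ∂ν) ^ γ))) ∧
      ∀ᶠ d : ℕ in atTop, u d ≤ 1 / (d : ℝ) * ∫ z, logPowerMoment (c d)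
        (d * B * (1 / (d : ℝ)) ^ γ) γ z ∂(gaussianPi (Fin d)) := by
  obtain ⟨K, hK⟩ := exists_integral_rpow_mean_le hγ (2 / t)
  have h1 := hc.tendsto_log_one_add ht
  have h2 := hc.tendsto_mul_div_one_add ht
  have h3 := hc.tendsto_tiltedVar ht
  have h4 : Tendsto (fun d : ℕ => ((1 / (d : ℝ)) * ∑ r, tiltedVar t (c d r)) ^ γ + K / √(d : ℝ))
      atTop (𝓝 ((∫ x, tiltedVar t x ∂ν) ^ γ)) := by
    simpa using (h3.rpow_const (Or.inr (by linarith : 0 ≤ γ))).add (tendsto_const_div_sqrt_nat K)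
  refine ⟨_, ((h1.const_mul (-(1 / 2))).sub (h2.const_mul (1 / 2))).add
    ((h3.const_mul (t / 2)).sub (h4.const_mul B)), ?_⟩
  filter_upwards [eventually_gt_atTop 0] with d hd
  have hd' : (0 : ℝ) < d := by exact_mod_cast hd
  have hv : ∀ i, 0 ≤ tiltedVar t (c d i) := fun i => tiltedVar_nonneg ht.le (hc.nonneg d i)
  have h5 := le_integral_logPowerMoment (hc.nonneg d)
    (a := d * B * (1 / (d : ℝ)) ^ γ) (by positivity) (by linarith : 0 ≤ γ) ht.le
  rw [← integral_const_mul] at h5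
  simp_rw [fun w : Fin d → ℝ => const_mul_rpow_mean (d := d) (γ := γ) (B := B)
    (Finset.sum_nonneg fun i (_ : i ∈ Finset.univ) => mul_nonneg (hv i) (sq_nonneg (w i)))] at h5
  rw [integral_const_mul, integral_const_mul] at h5
  have h6 := hK d hd _ hv fun i => tiltedVar_le ht (hc.nonneg d i)
  have h7 := mul_le_mul_of_nonneg_left h5 (by positivity : 0 ≤ 1 / (d : ℝ))
  have h8 := mul_le_mul_of_nonneg_left h6 hB
  refine le_trans ?_ h7
  have h9 : ∀ x y : ℝ, 1 / (d : ℝ) * (x + (y - d * (B * ∫ w : Fin d → ℝ,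
      (1 / (d : ℝ) * ∑ i, tiltedVar t (c d i) * w i ^ 2) ^ γ ∂(gaussianPi (Fin d))))) =
      1 / (d : ℝ) * x + 1 / (d : ℝ) * y - B * ∫ w : Fin d → ℝ,
      (1 / (d : ℝ) * ∑ i, tiltedVar t (c d i) * w i ^ 2) ^ γ ∂(gaussianPi (Fin d)) := by
    intro x y
    field_simp
    ring
  rw [h9]
  linarith

/-- Asymptotic upper bound for the average log-partition function. -/
lemma exists_tendsto_integral_logPowerMoment_le (hc : IsSpectralArray c ν) {γ B t l : ℝ}
    (hγ : 1 ≤ γ) (hB : 0 ≤ B) (ht : 0 ≤ t) (hl : 0 ≤ l) (htl : t / 2 = B * (γ * l ^ (γ - 1))) :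
    ∃ u : ℕ → ℝ, Tendsto u atTop (𝓝 (-(1 / 2) * (∫ x, Real.log (1 + t * x) ∂ν) -
      1 / 2 * (∫ x, t * x / (1 + t * x) ∂ν) + (t / 2 * l - B * l ^ γ))) ∧
      ∀ᶠ d : ℕ in atTop, 1 / (d : ℝ) * ∫ z, logPowerMoment (c d)
        (d * B * (1 / (d : ℝ)) ^ γ) γ z ∂(gaussianPi (Fin d)) ≤ u d := by
  have h12 : Tendsto (fun d : ℕ => -(1 / 2) * ((1 / (d : ℝ)) * ∑ r, Real.log (1 + t * c d r)) -
      1 / 2 * ((1 / (d : ℝ)) * ∑ r, t * c d r / (1 + t * c d r))) atTop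
      (𝓝 (-(1 / 2) * (∫ x, Real.log (1 + t * x) ∂ν) -
      1 / 2 * (∫ x, t * x / (1 + t * x) ∂ν))) := by
    rcases ht.eq_or_lt with rfl | ht
    -- At `t = 0` both spectral averages vanish identically, so the convergence lemmas, which need
    -- `t > 0`, are not required.
    · simp
    · exact ((hc.tendsto_log_one_add ht).const_mul _).sub
        ((hc.tendsto_mul_div_one_add ht).const_mul _)
  refine ⟨_, h12.add_const (t / 2 * l - B * l ^ γ), ?_⟩
  filter_upwards [eventually_gt_atTop 0] with d hd
  have hd' : (0 : ℝ) < d := by exact_mod_cast hd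
  have hq : 0 ≤ (d : ℝ) * l := by positivity
  have h5 := integral_logPowerMoment_le (hc.nonneg d)
    (a := d * B * (1 / (d : ℝ)) ^ γ) (by positivity) hγ ht hq
    (by rw [slope_const_mul_rpow hd hl, htl])
  rw [const_mul_rpow_mean hq, ← mul_assoc (1 / (d : ℝ)) (d : ℝ) l, one_div_mul_cancel hd'.ne',
    one_mul] at h5
  have h7 := mul_le_mul_of_nonneg_left h5 (by positivity : 0 ≤ 1 / (d : ℝ))
  refine h7.trans (le_of_eq ?_)
  have h8 : 1 / (d : ℝ) * (-(d * (B * l ^ γ)) + t / 2 * (d * l)) = t / 2 * l - B * l ^ γ := by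
    field_simp
    ring
  rw [mul_add, h8]
  ring

lemma tendsto_integral_logPowerMoment (hc : IsSpectralArray c ν) {γ B t l : ℝ}
    (hγ : 1 ≤ γ) (hB : 0 < B) (ht : 0 ≤ t) (hl : 0 ≤ l) (htl : t / 2 = B * (γ * l ^ (γ - 1)))
    (hlt : l = ∫ x, tiltedVar t x ∂ν) :
    Tendsto (fun d : ℕ => 1 / (d : ℝ) * ∫ z, logPowerMoment (c d)
        (d * B * (1 / (d : ℝ)) ^ γ) γ z ∂(gaussianPi (Fin d))) atTop
      (𝓝 (-(1 / 2) * (∫ x, Real.log (1 + t * x) ∂ν) -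
      1 / 2 * (∫ x, t * x / (1 + t * x) ∂ν) + (t / 2 * l - B * l ^ γ))) := by
  obtain ⟨u, hu, hule⟩ := hc.exists_tendsto_integral_logPowerMoment_le hγ hB.le ht hl htl
  suffices H : ∃ v : ℕ → ℝ, Tendsto v atTop (𝓝 (-(1 / 2) * (∫ x, Real.log (1 + t * x) ∂ν) -
      1 / 2 * (∫ x, t * x / (1 + t * x) ∂ν) + (t / 2 * l - B * l ^ γ))) ∧
      ∀ᶠ d : ℕ in atTop, v d ≤ 1 / (d : ℝ) * ∫ z, logPowerMoment (c d)
        (d * B * (1 / (d : ℝ)) ^ γ) γ z ∂(gaussianPi (Fin d)) by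
    obtain ⟨v, hv, hvle⟩ := H
    exact tendsto_of_tendsto_of_tendsto_of_le_of_le' hv hu hvle hule
  -- The lower bound needs `t > 0` for bounded weights. If `t = 0`, the slope equation forces `l =
  -- 0`, hence `ν` is concentrated at `0`; any positive tilt, here `1`, then gives the right limit
  -- because all its integrals vanish.
  rcases ht.eq_or_lt with rfl | ht
  · have hl0 : l = 0 := by
      by_contra h0
      have hl' : 0 < l := lt_of_le_of_ne hl (Ne.symm h0)
      have : 0 < B * (γ * l ^ (γ - 1)) := by positivity
      linarith
    have hν : ∀ᵐ x ∂ν, x = 0 := by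
      rw [hl0, eq_comm, integral_eq_zero_iff_of_nonneg_ae
        (hc.ae_nonneg.mono fun x hx => tiltedVar_nonneg le_rfl hx)
        (integrable_tiltedVar hc.ae_nonneg hc.integrable_id le_rfl)] at hlt
      filter_upwards [hlt] with x hx
      simp only [tiltedVar, Pi.zero_apply] at hx
      ring_nf at hx
      linarith
    obtain ⟨v, hv, hvle⟩ := hc.exists_tendsto_le_integral_logPowerMoment hγ hB.le one_pos
    refine ⟨v, ?_, hvle⟩
    have e1 : ∫ x, Real.log (1 + 1 * x) ∂ν = 0 :=
      integral_eq_zero_of_ae (hν.mono fun x hx => by simp [hx])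
    have e2 : ∫ x, 1 * x / (1 + 1 * x) ∂ν = 0 :=
      integral_eq_zero_of_ae (hν.mono fun x hx => by simp [hx])
    have e3 : ∫ x, tiltedVar 1 x ∂ν = 0 :=
      integral_eq_zero_of_ae (hν.mono fun x hx => by simp [hx, tiltedVar])
    rw [e1, e2, e3] at hv
    rw [hl0]
    simpa using hv
  · rw [hlt]
    exact hc.exists_tendsto_le_integral_logPowerMoment hγ hB.le ht

end IsSpectralArray

/-! ### Conclusion for Gaussian densities -/

lemma isSpectralArray_eigenvalues (C : ∀ d : ℕ, Matrix (Fin d) (Fin d) ℝ)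
    (hC : ∀ d, (C d).PosDef) (ρC : Measure ℝ)
    (hlim : HasLimitingEigenvalueDensity C (fun d => (hC d).isHermitian) ρC)
    (hmom : (fun d : ℕ => ∫ x, ‖x‖ ^ 2 ∂(multivariateGaussian 0 (C d)))
      =O[atTop] (fun d : ℕ => (d : ℝ))) :
    IsSpectralArray (fun d => (hC d).isHermitian.eigenvalues) ρC := by
  refine ⟨fun d r => (hC d).posSemidef.eigenvalues_nonneg r, hlim, ?_⟩
  obtain ⟨M, hM⟩ := hmom.bound
  refine ⟨M, ?_⟩
  filter_upwards [hM, eventually_gt_atTop 0] with d hd hd0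
  have hd' : (0 : ℝ) < d := by exact_mod_cast hd0
  rw [integral_multivariateGaussian (hC d).posSemidef (by fun_prop)] at hd
  simp_rw [norm_eigenMap_sq (hC d).posSemidef] at hd
  -- The second moment is the sum of the eigenvalues, so the moment hypothesis bounds their average.
  rw [integral_sum_mul_sq_gaussianPi, Real.norm_of_nonneg hd'.le] at hd
  rw [one_div, inv_mul_le_iff₀ hd', mul_comm]
  exact (le_abs_self _).trans hd

lemma isReplicaFreeEntropy_phiGauss {C : ∀ d : ℕ, Matrix (Fin d) (Fin d) ℝ}
    (hC : ∀ d, (C d).PosDef) {ρC : Measure ℝ} [IsProbabilityMeasure ρC]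
    (hc : IsSpectralArray (fun d => (hC d).isHermitian.eigenvalues) ρC) {γ α h m l t : ℝ}
    (hγ : 1 ≤ γ) (hh : 0 < h) (hm : 0 < m) (hl : 0 ≤ l) (ht : 0 ≤ t)
    (hS : SaddleEquations ρC γ h m l t) :
    IsReplicaFreeEntropy (fun d => multivariateGaussian 0 (C d)) (gammaKernel γ) α h m
      (phiGauss ρC γ α h m l t) := by
  obtain ⟨htl, hlt⟩ := (saddleEquations_iff hγ _ _ _ _).1 hS
  have hγ0 : 0 < γ := by linarith
  -- Chosen so that `B * x ^ γ = m * fGamma γ (x / h ^ 2)` for nonnegative `x`; the slope condition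
  -- at `l` is then the first saddle equation.
  set B : ℝ := m / (2 * γ) * (1 / h ^ 2) ^ γ with hB
  have hBl : B * l ^ γ = m * fGamma γ (l / h ^ 2) := by
    have : (l / h ^ 2) ^ γ = (1 / h ^ 2) ^ γ * l ^ γ := by
      rw [← Real.mul_rpow (by positivity) hl]
      congr 1
      ring
    rw [fGamma, this, hB]
    ring
  have hBt : t / 2 = B * (γ * l ^ (γ - 1)) := by
    have : (l / h ^ 2) ^ (γ - 1) = (1 / h ^ 2) ^ γ / (1 / h ^ 2) * l ^ (γ - 1) := by
      rw [← Real.rpow_sub_one (by positivity), ← Real.mul_rpow (by positivity) hl]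
      congr 1
      ring
    rw [htl, this, hB]
    field_simp
  refine ⟨fun d => integrable_logKernelMoment (hC d).posSemidef hγ hm,
    m * cGamma γ + (-(1 / 2) * (∫ x, Real.log (1 + t * x) ∂ρC) -
      1 / 2 * (∫ x, t * x / (1 + t * x) ∂ρC) + (t / 2 * l - B * l ^ γ)) - m * Real.log h, ?_, ?_⟩
  · refine (((tendsto_gammaNormalization hγ).const_mul m).add
      (hc.tendsto_integral_logPowerMoment hγ (by positivity) ht hl hBt hlt)).sub_const _
      |>.congr' ?_
    filter_upwards [eventually_gt_atTop 0] with d hd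
    have hd' : (d : ℝ) ≠ 0 := by exact_mod_cast hd.ne'
    rw [integral_logKernelMoment (hC d).posSemidef hγ hm, mul_add]
    congr 2
    field_simp
  · rw [hBl, phiGauss]
    field_simp
    ring

lemma saddleEquations_one_left {ρC : Measure ℝ} {h m l t : ℝ}
    (hS : SaddleEquations ρC 1 h m l t) : t = m / h ^ 2 := by
  have := ((saddleEquations_iff le_rfl _ _ _ _).1 hS).1
  simpa using this

/-- For `γ = 1` the function is affine in `l`, and at `t = m / h ^ 2` its two `l`-terms cancel, so
any `l` is allowed. -/
lemma phiGauss_one_eq_phiGaussKernel {ρC : Measure ℝ} [IsProbabilityMeasure ρC]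
    (hν : ∀ᵐ x ∂ρC, 0 ≤ x) (hi : Integrable (fun x : ℝ => x) ρC) {α h m : ℝ} (hh : 0 < h)
    (hm : 0 < m) (l : ℝ) : phiGauss ρC 1 α h m l (m / h ^ 2) = phiGaussKernel ρC α h m := by
  have h1 : ∫ x, Real.log (h ^ 2 + m * x) ∂ρC =
      2 * Real.log h + ∫ x, Real.log (1 + m / h ^ 2 * x) ∂ρC := by
    have h2 : ∫ x, Real.log (h ^ 2 + m * x) ∂ρC =
        ∫ x, (2 * Real.log h + Real.log (1 + m / h ^ 2 * x)) ∂ρC := by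
      refine integral_congr_ae ?_
      filter_upwards [hν] with x hx
      have h3 : h ^ 2 + m * x = h ^ 2 * (1 + m / h ^ 2 * x) := by
        field_simp
      rw [h3, Real.log_mul (by positivity) (by positivity), Real.log_pow]
      norm_num
    rw [h2, integral_add (integrable_const _) (integrable_log_one_add hν hi (by positivity))]
    simp
  have h4 : ∫ x, m / h ^ 2 * x / (1 + m / h ^ 2 * x) ∂ρC =
      m * ∫ x, x / (h ^ 2 + m * x) ∂ρC := by
    rw [← integral_const_mul]
    refine integral_congr_ae ?_
    filter_upwards [hν] with x hx
    have : h ^ 2 + m * x ≠ 0 := by positivity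
    have : 1 + m / h ^ 2 * x ≠ 0 := by positivity
    field_simp
  rw [phiGauss, phiGaussKernel, h1, h4, cGamma, fGamma, Real.rpow_one]
  field_simp
  ring

theorem proposition10
    (C : ∀ d : ℕ, Matrix (Fin d) (Fin d) ℝ) (hC : ∀ d, (C d).PosDef)
    (ρC : Measure ℝ) [IsProbabilityMeasure ρC]
    (hlim : HasLimitingEigenvalueDensity C (fun d => (hC d).isHermitian) ρC)
    (hmom : (fun d : ℕ => ∫ x, ‖x‖ ^ 2 ∂(multivariateGaussian 0 (C d)))
      =O[atTop] (fun d : ℕ => (d : ℝ))) :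
    IsPureDensity (fun d => multivariateGaussian 0 (C d)) ∧
    (∀ᵐ c ∂ρC, 0 ≤ c) ∧ Integrable (fun c : ℝ => c) ρC ∧
    (∀ γ α h m : ℝ, 1 ≤ γ → 0 < h → 0 < m →
      (∃! p : ℝ × ℝ, 0 ≤ p.1 ∧ 0 ≤ p.2 ∧ SaddleEquations ρC γ h m p.1 p.2) ∧
      (∀ l t : ℝ, 0 ≤ l → 0 ≤ t →
        (SaddleEquations ρC γ h m l t ↔ IsStationaryPhiGauss ρC γ α h m l t)) ∧
      (∀ l t : ℝ, 0 ≤ l → 0 ≤ t → SaddleEquations ρC γ h m l t →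
        IsReplicaFreeEntropy (fun d => multivariateGaussian 0 (C d)) (gammaKernel γ) α h m
          (phiGauss ρC γ α h m l t))) ∧
    (∀ α h m : ℝ, 0 < h → 0 < m →
      (∀ l t : ℝ, SaddleEquations ρC 1 h m l t → t = m / h ^ 2) ∧
      IsReplicaFreeEntropy (fun d => multivariateGaussian 0 (C d)) (gammaKernel 1) α h m
        (phiGaussKernel ρC α h m)) := by
  have hc := isSpectralArray_eigenvalues C hC ρC hlim hmom
  have hν := hc.ae_nonneg
  have hi := hc.integrable_id
  refine ⟨isPureDensity_multivariateGaussian C hC, hν, hi, fun γ α h m hγ hh hm => ⟨?_, ?_, ?_⟩,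
    fun α h m hh hm => ⟨fun l t hS => saddleEquations_one_left hS, ?_⟩⟩
  · exact existsUnique_saddleEquations hν hi hγ hm
  · exact fun l t hl ht => saddleEquations_iff_isStationaryPhiGauss hν hi hγ hh hm hl ht
  · exact fun l t hl ht hS => isReplicaFreeEntropy_phiGauss hC hc hγ hh hm hl ht hS
  · obtain ⟨⟨l, t⟩, ⟨hl, ht, hS⟩, -⟩ := existsUnique_saddleEquations (h := h) hν hi le_rfl hm
    have h1 := isReplicaFreeEntropy_phiGauss (α := α) hC hc le_rfl hh hm hl ht hS
    rwa [saddleEquations_one_left hS, phiGauss_one_eq_phiGaussKernel hν hi hh hm] at h1
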